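/- Let $K\ge 2$, $T\ge 0$ be integers, let $\ell_1,\dots,\ell_T\in[0,1]^K$ be a fixed (oblivious) sequence of loss vectors, and let $d_1,\dots,d_T\in\{0,1,2,\dots\}$ be a fixed sequence of delays. In round $t\in[T]=\{1,\dots,T\}$ a learner draws an action $A_t\in[K]$ and suffers $\ell_{t,A_t}$; this loss is observed at the end of round $t+d_t$. Let $O_t=\{s\in[t-1]: s+d_s\ge t\}$ be the set of rounds whose feedback is missing when $A_t$ is chosen. Skipping. Indicators $a_s^t\in\{0,1\}$ and counters are defined recursively over time by $$\tilde\tau_t=\sum_{s\in O_t}a_s^t,\qquad \tilde D_t=\sum_{s=1}^t\tilde\tau_s .$$ Initially all $a_s^t$ equal $1$; if at time $t$ some $s\in O_t$ satisfies $\min\{d_s,t-s\}>\sqrt{\tilde D_t/\log K}$, then $a_s^{t'}=0$ for all $t'>t$ (round $s$ is skipped). Algorithm (DAda-Exp3 with skipping). Given step sizes $\eta_t>0$ and exploration parameters $\gamma_t\ge0$, conditionally on $A_1,\dots,A_{t-1}$ the action $A_t$ is drawn from $$p_{t,i}=\frac{\exp(-\eta_t\hat L_{t,i})}{\sum_{j=1}^K\exp(-\eta_t\hat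 L_{t,j})},\qquad \hat L_{t,i}=\sum_{\substack{s<t:\ s+d_s<t,\\ a_s^t=1}}\hat\ell_{s,i},\qquad \hat\ell_{s,i}=\frac{\ell_{s,i}\,\mathbb 1\{A_s=i\}}{p_{s,i}+\gamma_s},$$ that is, from exponential weights over the loss estimates that have arrived and belong to rounds not skipped (a skipped round is treated as having loss $0$). For $R\subseteq[T]$ let $D_{\bar R}=\sum_{t\in[T]\setminus R}d_t$, and put $$M=\max\Big\{2\log K,\ \min_{R\subseteq[T]}\big(|R|+\sqrt{D_{\bar R}\log K}\big)\Big\}.$$ (i) If $\gamma_t=0$ and $\eta_t=\sqrt{\dfrac{\log K}{tK+\sum_{s=1}^t\tilde\tau_s}}$, then for every action $A^\star\in[K]$ $$\sum_{t=1}^T\big(\mathbb E[\ell_{t,A_t}]-\ell_{t,A^\star}\big)\le 3\sqrt{TK\log K}+10\,M .$$ (ii) If $\eta_t=\gamma_t=\dfrac12\sqrt{\dfrac{3\log K}{2tK+\sum_{s=1}^t\tilde\tau_s}}$, then for every $\delta\in(0,1)$, with probability at least $1-\delta$, simultaneously for all $A^\star\in[K]$, $$\sum_{t=1}^T\big(\ell_{t,A_t}-\ell_{t,A^\star}\big)\le\Big(c_1+c_2\frac{\log(2/\delta)}{\log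 K}\Big)\sqrt{KT\log K}+\Big(c_3+c_4\frac{\log(2/\delta)}{\log K}\Big)M,$$ where $c_1=2\sqrt6$, $c_2=\sqrt{2/3}$, $c_3=4(\sqrt3+1)$, $c_4=1+2/\sqrt3$. -/

import Mathlib

namespace DelayedBandit

/-- `O_t = {s ∈ [t-1] : s + d_s ≥ t}`: the rounds whose feedback is missing when the decision of
round `t` is made.  Rounds are numbered from `1`. -/
def missing (d : ℕ → ℕ) (t : ℕ) : Finset ℕ :=
  (Finset.Ico 1 t).filter fun s => t ≤ s + d s

/-- The bookkeeping of the skipping procedure. At time `t` the state is the pair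
`(s ↦ a_s^t, D̃_t)`. All indicators start at `1`; if at time `t` a round `s ∈ O_t` satisfies
`min {d_s, t - s} > √(D̃_t / log K)`, then `a_s^{t'} = 0` for all `t' > t`. The counter then grows by
`τ̃_{t+1} = ∑_{s ∈ O_{t+1}} a_s^{t+1}`. -/
noncomputable def skipState (K : ℕ) (d : ℕ → ℕ) : ℕ → (ℕ → ℕ) × ℕ
  | 0 => (fun _ => 1, 0)
  | t + 1 =>
    let a : ℕ → ℕ := (skipState K d t).1
    let D : ℕ := (skipState K d t).2
    let a' : ℕ → ℕ := open Classical in fun s =>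
      if s ∈ missing d t ∧ √((D : ℝ) / Real.log K) < ((min (d s) (t - s) : ℕ) : ℝ) then 0 else a s
    (a', D + ∑ s ∈ missing d (t + 1), a' s)

/-- The indicator `a_s^t ∈ {0, 1}`: it is `0` when round `s` has been skipped before time `t`. -/
noncomputable def counted (K : ℕ) (d : ℕ → ℕ) (s t : ℕ) : ℕ := (skipState K d t).1 s

/-- `τ̃_t`, the number of counted missing feedbacks at time `t`. -/
noncomputable def countedMissing (K : ℕ) (d : ℕ → ℕ) (t : ℕ) : ℕ :=
  ∑ s ∈ missing d t, counted K d s t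

/-- `D̃_t = ∑_{s=1}^t τ̃_s`. -/
noncomputable def cumCountedMissing (K : ℕ) (d : ℕ → ℕ) (t : ℕ) : ℕ :=
  ∑ s ∈ Finset.Icc 1 t, countedMissing K d s

theorem skipState_snd (K : ℕ) (d : ℕ → ℕ) (t : ℕ) :
    (skipState K d t).2 = cumCountedMissing K d t := by
  induction t with
  | zero => simp [skipState, cumCountedMissing]
  | succ t ih =>
    rw [cumCountedMissing, Finset.sum_Icc_succ_top (by omega), ← cumCountedMissing, ← ih]
    rfl

theorem counted_zero (K : ℕ) (d : ℕ → ℕ) (s : ℕ) : counted K d s 0 = 1 := by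
  simp [counted, skipState]

open Classical in
/-- The update rule of the indicators. -/
theorem counted_succ (K : ℕ) (d : ℕ → ℕ) (s t : ℕ) :
    counted K d s (t + 1) =
      if s ∈ missing d t ∧
          √((cumCountedMissing K d t : ℝ) / Real.log K) < ((min (d s) (t - s) : ℕ) : ℝ)
      then 0 else counted K d s t := by
  rw [← skipState_snd]
  rfl

/-- The rounds whose loss estimates enter the decision of round `t`: the feedback arrived before
time `t`, and the round has not been skipped. -/
noncomputable def used (K : ℕ) (d : ℕ → ℕ) (t : ℕ) : Finset ℕ :=
  (Finset.Ico 1 t).filter fun s => s + d s < t ∧ counted K d s t = 1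

/-- Exponential weights with step size `η` and cumulative loss vector `L`. -/
noncomputable def expWeights {K : ℕ} (η : ℝ) (L : Fin K → ℝ) (i : Fin K) : ℝ :=
  Real.exp (-η * L i) / ∑ j, Real.exp (-η * L j)

/-- The loss estimate `ℓ_i 𝟙{a = i} / (p_i + γ)`: importance weighting for `γ = 0`, implicit
exploration for `γ > 0`. -/
noncomputable def lossEstimate {K : ℕ} (γ : ℝ) (loss p : Fin K → ℝ) (a i : Fin K) : ℝ :=
  loss i * (if a = i then 1 else 0) / (p i + γ)

/-- The distribution `p_t` computed by DAda-Exp3 with skipping (step sizes `η`, exploration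
parameters `γ`) when the sequence of actions is `a`. It depends on `a` only through the rounds
in `used K d t`. -/
noncomputable def distr {K : ℕ} (ℓ : ℕ → Fin K → ℝ) (d : ℕ → ℕ) (η γ : ℕ → ℝ) (a : ℕ → Fin K)
    (t : ℕ) : Fin K → ℝ :=
  expWeights (η t) fun i =>
    ∑ s : Fin t, if (s : ℕ) ∈ used K d t then
      lossEstimate (γ s) (ℓ s) (distr ℓ d η γ a s) (a s) i else 0
  termination_by t
  decreasing_by exact s.2

theorem distr_eq {K : ℕ} (ℓ : ℕ → Fin K → ℝ) (d : ℕ → ℕ) (η γ : ℕ → ℝ) (a : ℕ → Fin K) (t : ℕ) :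
    distr ℓ d η γ a t = expWeights (η t) fun i =>
      ∑ s ∈ used K d t, lossEstimate (γ s) (ℓ s) (distr ℓ d η γ a s) (a s) i := by
  rw [distr]
  congr 1
  funext i
  rw [Fin.sum_univ_eq_sum_range (fun s => if s ∈ used K d t then
      lossEstimate (γ s) (ℓ s) (distr ℓ d η γ a s) (a s) i else 0) t, ← Finset.sum_filter]
  congr 1
  ext s
  simp only [used, Finset.mem_filter, Finset.mem_range, Finset.mem_Ico]
  tauto

/-- The random actions `A_1, …, A_T` are generated by DAda-Exp3 with skipping: conditionally on
the previous actions, `A_t` is drawn from `p_t`. -/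
structure IsRun {K : ℕ} {Ω : Type*} [MeasurableSpace Ω] (μ : MeasureTheory.Measure Ω) (T : ℕ)
    (ℓ : ℕ → Fin K → ℝ) (d : ℕ → ℕ) (η γ : ℕ → ℝ) (A : ℕ → Ω → Fin K) : Prop where
  measurable : ∀ t ∈ Finset.Icc 1 T, Measurable (A t)
  law : ∀ t ∈ Finset.Icc 1 T, ∀ a : ℕ → Fin K,
    μ.real {ω | ∀ s ∈ Finset.Icc 1 t, A s ω = a s} =
      μ.real {ω | ∀ s ∈ Finset.Ico 1 t, A s ω = a s} * distr ℓ d η γ a t (a t)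

/-- Step sizes `η_t = √(log K / (t K + ∑_{s ≤ t} τ̃_s))`. -/
noncomputable def stepSize (K : ℕ) (d : ℕ → ℕ) (t : ℕ) : ℝ :=
  √(Real.log K / (t * K + cumCountedMissing K d t))

/-- Step sizes `η_t = (1/2) √(3 log K / (2 t K + ∑_{s ≤ t} τ̃_s))`. -/
noncomputable def stepSizeIX (K : ℕ) (d : ℕ → ℕ) (t : ℕ) : ℝ :=
  1 / 2 * √(3 * Real.log K / (2 * t * K + cumCountedMissing K d t))

/-- `min_{R ⊆ [T]} (|R| + √(D_{R̄} log K))`, where `D_{R̄} = ∑_{t ∈ [T] ∖ R} d_t`. -/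
noncomputable def bestSkip (K T : ℕ) (d : ℕ → ℕ) : ℝ :=
  (Finset.Icc 1 T).powerset.inf' ⟨∅, Finset.empty_mem_powerset _⟩ fun R =>
    (R.card : ℝ) + √((∑ t ∈ Finset.Icc 1 T \ R, (d t : ℝ)) * Real.log K)

end DelayedBandit

/-! The rounds split into those skipped at some time up to `T` and those never skipped (`kept`).
Skipped rounds cost at most 1 each. On kept rounds the algorithm is compared with a clairvoyant
exponential weights forecaster that knows the estimates of all kept rounds up to and including the
current one. Its regret against any action, measured in estimated losses, is at most `log K / η_T`
(`sum_inner_le`), with no second-order term. Since a round that has arrived can no longer be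
skipped, the cumulative losses of the two forecasters differ exactly by the estimate of the current
round and those of the missing kept rounds. The price of this gap is `drift` (`sum_kept_le`).

Controlling the drift means averaging `p_{t,j}` times the estimate of a round `s` missing at time
`t`. Here `p_t` is not known when `A_s` is drawn, yet it does not depend on `A_s`. The joint law of
the actions is the product of the factors `p_{q,A_q}`, and `p_q` depends only on rounds `r` with `r
+ d_r < q`. The same product can therefore be sampled in order of decision (key `s`) or in order of
arrival (key `s + d_s`). In arrival order `p_s` and `p_t` are both determined before `A_s`, so
averaging over `A_s` replaces the estimate by at most the true loss. All expectations are finite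
sums over action paths, computed by summing out the coordinate with the largest key
(`pathExp_resample`, `pathExp_prod_le_one`).

For the skipping rule, put `Y = √(D̃_T log K)`. Rounds outside a competing set `R` are counted at
most `d_s` times and those in `R` at most `1 + √(D̃_T / log K)` times, so `Y ≤ 7/5 M`
(`sqrt_cumCountedMissing_mul_le`). A skipped round has already used more counted time than the
threshold, which leads to at most `2 Y` skipped rounds (`card_skipped_le`).

In expectation this gives the first bound. With high probability three exponential moments are
needed: for the estimates of the best fixed action, for the truncated drift in decision order, and
for the weighted missing estimates in arrival order (`pathExp_exp_estimate_le`,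
`pathExp_exp_drift_le`). The skipping threshold bounds how long a kept round is missing, which keeps
the weights in the third within the range that implicit exploration allows. -/

namespace DelayedBandit

open Finset Function

/-! ### Finite sums over action paths and reordering of the draws. -/

section PathSums

variable {α : Type*}

/-- The functions that take a default value outside of `S`. -/
def pathSet (i₀ : α) (S : Finset ℕ) : Set (ℕ → α) := {a | ∀ t, t ∉ S → a t = i₀}

theorem pathSet_finite [Finite α] (i₀ : α) (S : Finset ℕ) : (pathSet i₀ S).Finite := by
  refine Set.Finite.of_injOn (f := fun a (s : S) => a s) (t := Set.univ) (fun _ _ => trivial) ?_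
    Set.finite_univ
  intro a ha b hb h
  funext t
  by_cases ht : t ∈ S
  · exact congrFun h ⟨t, ht⟩
  · rw [ha t ht, hb t ht]

/-- Reset a path to the default value outside of `S`. -/
def restrictPath (i₀ : α) (S : Finset ℕ) (a : ℕ → α) : ℕ → α := fun t => if t ∈ S then a t else i₀

theorem restrictPath_of_mem {i₀ : α} {S : Finset ℕ} {t : ℕ} (ht : t ∈ S) (a : ℕ → α) :
    restrictPath i₀ S a t = a t := by
  simp [restrictPath, ht]

variable [Fintype α]

/-- The finitely many functions that take a default value outside of `S`. -/
noncomputable def paths (i₀ : α) (S : Finset ℕ) : Finset (ℕ → α) := (pathSet_finite i₀ S).toFinset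

theorem mem_paths {i₀ : α} {S : Finset ℕ} {a : ℕ → α} :
    a ∈ paths i₀ S ↔ ∀ t, t ∉ S → a t = i₀ := by
  simp [paths, pathSet]

theorem paths_empty (i₀ : α) : paths i₀ ∅ = {fun _ => i₀} := by
  ext a
  simp [mem_paths, funext_iff]

theorem sum_paths_insert (i₀ : α) {S : Finset ℕ} {r : ℕ} (hr : r ∉ S) (H : (ℕ → α) → ℝ) :
    ∑ b ∈ paths i₀ (insert r S), H b = ∑ a ∈ paths i₀ S, ∑ i, H (update a r i) := by
  rw [← Finset.sum_product']
  symm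
  refine Finset.sum_bij' (fun x _ => update x.1 r x.2) (fun b _ => (update b r i₀, b r))
    ?_ ?_ ?_ ?_ ?_
  · rintro ⟨a, i⟩ h
    simp only [mem_product, mem_univ, and_true, mem_paths] at h ⊢
    intro t ht
    simp only [mem_insert, not_or] at ht
    rw [update_of_ne ht.1, h t ht.2]
  · intro b h
    simp only [mem_product, mem_univ, and_true, mem_paths] at h ⊢
    intro t ht
    by_cases htr : t = r
    · subst htr; simp
    · rw [update_of_ne htr, h t (by simp [htr, ht])]
  · rintro ⟨a, i⟩ h
    simp only [mem_product, mem_univ, and_true, mem_paths] at h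
    simp [← h r hr]
  · intro b _
    simp
  · intro x _
    rfl

/-- Expectation of `f` when the coordinates in `S` of a path are drawn from the kernels `p`, the
other ones being equal to the default value. -/
noncomputable def pathExp (i₀ : α) (p : ℕ → (ℕ → α) → α → ℝ) (S : Finset ℕ)
    (f : (ℕ → α) → ℝ) : ℝ :=
  ∑ a ∈ paths i₀ S, (∏ q ∈ S, p q a (a q)) * f a

variable {i₀ : α} {p : ℕ → (ℕ → α) → α → ℝ} {S : Finset ℕ}

theorem pathExp_add (f g : (ℕ → α) → ℝ) :
    pathExp i₀ p S (fun a => f a + g a) = pathExp i₀ p S f + pathExp i₀ p S g := by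
  simp [pathExp, mul_add, Finset.sum_add_distrib]

theorem pathExp_const_mul (c : ℝ) (f : (ℕ → α) → ℝ) :
    pathExp i₀ p S (fun a => c * f a) = c * pathExp i₀ p S f := by
  simp only [pathExp, Finset.mul_sum]
  exact Finset.sum_congr rfl fun a _ => by ring

theorem pathExp_sum {ι : Type*} (I : Finset ι) (f : ι → (ℕ → α) → ℝ) :
    pathExp i₀ p S (fun a => ∑ j ∈ I, f j a) = ∑ j ∈ I, pathExp i₀ p S (f j) := by
  simp only [pathExp, Finset.mul_sum]
  exact Finset.sum_comm

theorem pathExp_mono (hp : ∀ q a i, 0 ≤ p q a i) {f g : (ℕ → α) → ℝ} (h : ∀ a, f a ≤ g a) :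
    pathExp i₀ p S f ≤ pathExp i₀ p S g :=
  Finset.sum_le_sum fun a _ =>
    mul_le_mul_of_nonneg_left (h a) (Finset.prod_nonneg fun _ _ => hp _ _ _)

/-- No kernel sees coordinate `r`, so it may be drawn last, whatever its place in time. -/
theorem pathExp_insert {r : ℕ} (hr : r ∉ S)
    (hp : ∀ q ∈ insert r S, ∀ a i, p q (update a r i) = p q a) (f : (ℕ → α) → ℝ) :
    pathExp i₀ p (insert r S) f =
      pathExp i₀ p S (fun a => ∑ i, p r a i * f (update a r i)) := by
  rw [pathExp, sum_paths_insert i₀ hr, pathExp]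
  refine Finset.sum_congr rfl fun a _ => ?_
  rw [Finset.mul_sum]
  refine Finset.sum_congr rfl fun i _ => ?_
  rw [Finset.prod_insert hr, hp r (mem_insert_self _ _), update_self]
  have : ∏ q ∈ S, p q (update a r i) (update a r i q) = ∏ q ∈ S, p q a (a q) := by
    refine Finset.prod_congr rfl fun q hq => ?_
    rw [hp q (mem_insert_of_mem hq), update_of_ne (ne_of_mem_of_not_mem hq hr)]
  rw [this]
  ring

/-- A product of nonnegative factors, each with conditional mean at most one given the
coordinates with a smaller key, has mean at most one. -/
theorem pathExp_prod_le_one (key : ℕ → ℕ) (g : ℕ → (ℕ → α) → ℝ)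
    (hp0 : ∀ q a i, 0 ≤ p q a i)
    (hp : ∀ q r, key q ≤ key r → ∀ a i, p q (update a r i) = p q a)
    (hg0 : ∀ q a, 0 ≤ g q a)
    (hg : ∀ q r, q ≠ r → key q ≤ key r → ∀ a i, g q (update a r i) = g q a)
    (hstep : ∀ q ∈ S, ∀ a, ∑ i, p q a i * g q (update a q i) ≤ 1) :
    pathExp i₀ p S (fun a => ∏ q ∈ S, g q a) ≤ 1 := by
  -- The coordinate with the largest key is summed out first; ties are harmless because a kernel
  -- ignores coordinates with an equal key.
  induction S using Finset.induction_on_max_value key with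
  | empty => simp [pathExp, paths_empty]
  | insert r S hr hmax ih =>
    have hkey : ∀ q ∈ insert r S, key q ≤ key r := by
      intro q hq
      rcases mem_insert.1 hq with rfl | hq
      · exact le_rfl
      · exact hmax q hq
    rw [pathExp_insert hr fun q hq => hp q r (hkey q hq)]
    refine (pathExp_mono hp0 fun a => ?_).trans
      (ih fun q hq => hstep q (mem_insert_of_mem hq))
    have : ∀ i, p r a i * ∏ q ∈ insert r S, g q (update a r i) =
        (p r a i * g r (update a r i)) * ∏ q ∈ S, g q a := by
      intro i
      rw [Finset.prod_insert hr, Finset.prod_congr rfl fun q hq =>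
        hg q r (fun h => hr (h ▸ hq)) (hmax q hq) a i]
      ring
    rw [Finset.sum_congr rfl fun i _ => this i, ← Finset.sum_mul]
    exact mul_le_of_le_one_left (Finset.prod_nonneg fun q _ => hg0 q a)
      (hstep r (mem_insert_self _ _) a)

/-- If `f` depends only on coordinate `r` and on coordinates with a smaller key, then drawing
coordinate `r` anew does not change the expectation of `f`. -/
theorem pathExp_resample (key : ℕ → ℕ) (hp1 : ∀ q a, ∑ i, p q a i = 1)
    (hp : ∀ q r, key q ≤ key r → ∀ a i, p q (update a r i) = p q a)
    {r : ℕ} (hr : r ∈ S) (f : (ℕ → α) → ℝ)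
    (hf : ∀ q, q ≠ r → key r ≤ key q → ∀ a i, f (update a q i) = f a) :
    pathExp i₀ p S f = pathExp i₀ p S (fun a => ∑ i, p r a i * f (update a r i)) := by
  induction S using Finset.induction_on_max_value key with
  | empty => simp at hr
  | insert q S hq hmax ih =>
    have hkey : ∀ q' ∈ insert q S, key q' ≤ key q := by
      intro q' hq'
      rcases mem_insert.1 hq' with rfl | hq'
      · exact le_rfl
      · exact hmax q' hq'
    rw [pathExp_insert hq fun q' hq' => hp q' q (hkey q' hq'),
      pathExp_insert hq fun q' hq' => hp q' q (hkey q' hq')]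
    -- If `r` itself has the largest key, redrawing it twice is redrawing it once. Otherwise the
    -- removed coordinate `q` is invisible to `f` and to the kernel of `r`, and integrates to one.
    rcases mem_insert.1 hr with rfl | hrS
    · congr 1
      funext a
      simp only [hp r r le_rfl, update_idem]
      rw [← Finset.sum_mul, hp1, one_mul]
    · have hne : q ≠ r := fun h => hq (h ▸ hrS)
      have hle := hmax r hrS
      have e1 : (fun a => ∑ i, p q a i * f (update a q i)) = f := by
        funext a
        rw [Finset.sum_congr rfl fun i _ => by rw [hf q hne hle a i], ← Finset.sum_mul, hp1,
          one_mul]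
      have e2 : (fun a => ∑ i, p q a i *
            ∑ j, p r (update a q i) j * f (update (update a q i) r j)) =
          fun a => ∑ j, p r a j * f (update a r j) := by
        funext a
        have : ∀ i, ∑ j, p r (update a q i) j * f (update (update a q i) r j) =
            ∑ j, p r a j * f (update a r j) := by
          intro i
          refine Finset.sum_congr rfl fun j _ => ?_
          rw [hp r q hle, update_comm hne, hf q hne hle]
        rw [Finset.sum_congr rfl fun i _ => by rw [this i], ← Finset.sum_mul, hp1, one_mul]
      rw [e1, e2]
      exact ih hrS

theorem pathExp_const (key : ℕ → ℕ) (hp1 : ∀ q a, ∑ i, p q a i = 1)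
    (hp : ∀ q r, key q ≤ key r → ∀ a i, p q (update a r i) = p q a) (c : ℝ) :
    pathExp i₀ p S (fun _ => c) = c := by
  induction S using Finset.induction_on_max_value key with
  | empty => simp [pathExp, paths_empty]
  | insert r S hr hmax ih =>
    have hkey : ∀ q ∈ insert r S, key q ≤ key r := by
      intro q hq
      rcases mem_insert.1 hq with rfl | hq
      · exact le_rfl
      · exact hmax q hq
    rw [pathExp_insert hr fun q hq => hp q r (hkey q hq)]
    simp only [← Finset.sum_mul, hp1, one_mul]
    exact ih

theorem restrictPath_mem_paths (a : ℕ → α) : restrictPath i₀ S a ∈ paths i₀ S := by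
  rw [mem_paths]
  intro t ht
  simp [restrictPath, ht]

theorem restrictPath_eq_iff {a b : ℕ → α} (hb : b ∈ paths i₀ S) :
    restrictPath i₀ S a = b ↔ ∀ s ∈ S, a s = b s := by
  constructor
  · rintro rfl s hs
    rw [restrictPath_of_mem hs]
  · intro h
    funext t
    by_cases ht : t ∈ S
    · rw [restrictPath_of_mem ht, h t ht]
    · rw [mem_paths.1 hb t ht]
      simp [restrictPath, ht]

end PathSums

/-! ### From the probability space to path sums. -/

section Law

open MeasureTheory

variable {K : ℕ} {Ω : Type*} [MeasurableSpace Ω] {μ : Measure Ω}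
  {T : ℕ} {ℓ : ℕ → Fin K → ℝ} {d : ℕ → ℕ} {η γ : ℕ → ℝ} {A : ℕ → Ω → Fin K}

theorem IsRun.measureReal_eq_prod [IsProbabilityMeasure μ] (h : IsRun μ T ℓ d η γ A)
    (a : ℕ → Fin K) {t : ℕ} (ht : t ≤ T) :
    μ.real {ω | ∀ s ∈ Icc 1 t, A s ω = a s} = ∏ s ∈ Icc 1 t, distr ℓ d η γ a s (a s) := by
  induction t with
  | zero => simp
  | succ t ih =>
    rw [h.law (t + 1) (by simp [ht]) a, Finset.prod_Icc_succ_top (by omega), ← ih (by omega)]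
    have : Ico 1 (t + 1) = Icc 1 t := by ext; simp
    rw [this]

theorem IsRun.measurableSet_eq (h : IsRun μ T ℓ d η γ A) (a : ℕ → Fin K) :
    MeasurableSet {ω | ∀ s ∈ Icc 1 T, A s ω = a s} := by
  have : {ω | ∀ s ∈ Icc 1 T, A s ω = a s} = ⋂ s ∈ Icc 1 T, A s ⁻¹' {a s} := by
    ext; simp
  rw [this]
  exact Finset.measurableSet_biInter _ fun s hs => h.measurable s hs (measurableSet_singleton _)

/-- The path is reset outside `[T]`, where nothing is assumed about `A`; what remains takes finitely
many values, each with the product probability. -/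
theorem IsRun.integral_eq [IsProbabilityMeasure μ] (h : IsRun μ T ℓ d η γ A) (i₀ : Fin K)
    (f : (ℕ → Fin K) → ℝ) :
    ∫ ω, f (restrictPath i₀ (Icc 1 T) fun t => A t ω) ∂μ =
      pathExp i₀ (fun t a => distr ℓ d η γ a t) (Icc 1 T) f := by
  have e : ∀ ω, f (restrictPath i₀ (Icc 1 T) fun t => A t ω) =
      ∑ a ∈ paths i₀ (Icc 1 T), {ω | ∀ s ∈ Icc 1 T, A s ω = a s}.indicator (fun _ => f a) ω := by
    intro ω
    rw [Finset.sum_eq_single_of_mem (restrictPath i₀ (Icc 1 T) fun t => A t ω)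
      (restrictPath_mem_paths _)]
    · rw [Set.indicator_of_mem]
      exact (restrictPath_eq_iff (restrictPath_mem_paths _)).1 rfl
    · intro b hb hne
      rw [Set.indicator_of_notMem]
      intro hω
      exact hne ((restrictPath_eq_iff hb).2 hω).symm
  simp_rw [e]
  rw [integral_finsetSum _ fun a _ => (integrable_const _).indicator (h.measurableSet_eq a)]
  refine Finset.sum_congr rfl fun a _ => ?_
  rw [integral_indicator_const _ (h.measurableSet_eq a), h.measureReal_eq_prod a le_rfl,
    smul_eq_mul]

/-- Markov's inequality, by a union bound over the finitely many paths that satisfy `P`. -/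
theorem IsRun.measureReal_le [IsProbabilityMeasure μ] (h : IsRun μ T ℓ d η γ A) (i₀ : Fin K)
    (hp0 : ∀ q a i, 0 ≤ distr ℓ d η γ a q i) (P : (ℕ → Fin K) → Prop)
    (f : (ℕ → Fin K) → ℝ) (hf0 : ∀ a, 0 ≤ f a) (hf : ∀ a, P a → 1 ≤ f a) :
    μ.real {ω | P (restrictPath i₀ (Icc 1 T) fun t => A t ω)} ≤
      pathExp i₀ (fun t a => distr ℓ d η γ a t) (Icc 1 T) f := by
  classical
  have hsub : {ω | P (restrictPath i₀ (Icc 1 T) fun t => A t ω)} ⊆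
      ⋃ a ∈ (paths i₀ (Icc 1 T)).filter P, {ω | ∀ s ∈ Icc 1 T, A s ω = a s} := by
    intro ω hω
    simp only [Set.mem_iUnion]
    exact ⟨_, Finset.mem_filter.2 ⟨restrictPath_mem_paths _, hω⟩,
      (restrictPath_eq_iff (restrictPath_mem_paths _)).1 rfl⟩
  refine (measureReal_mono hsub (measure_ne_top _ _)).trans
    ((measureReal_biUnion_finset_le _ _).trans ?_)
  rw [Finset.sum_filter]
  refine Finset.sum_le_sum fun a _ => ?_
  rw [h.measureReal_eq_prod a le_rfl]
  have h0 : 0 ≤ ∏ s ∈ Icc 1 T, distr ℓ d η γ a s (a s) := Finset.prod_nonneg fun s _ => hp0 _ _ _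
  split_ifs with hP
  · exact le_mul_of_one_le_right h0 (hf a hP)
  · exact mul_nonneg h0 (hf0 a)

end Law

/-! ### Exponential weights and their potential. -/

section ExpWeights

variable {K : ℕ}

theorem sum_exp_pos (hK : 0 < K) (η : ℝ) (L : Fin K → ℝ) : 0 < ∑ j, Real.exp (-η * L j) :=
  Finset.sum_pos (fun _ _ => Real.exp_pos _) ⟨⟨0, hK⟩, Finset.mem_univ _⟩

theorem expWeights_pos (hK : 0 < K) (η : ℝ) (L : Fin K → ℝ) (i : Fin K) : 0 < expWeights η L i :=
  div_pos (Real.exp_pos _) (sum_exp_pos hK η L)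

theorem sum_expWeights (hK : 0 < K) (η : ℝ) (L : Fin K → ℝ) : ∑ i, expWeights η L i = 1 := by
  simp only [expWeights]
  rw [← Finset.sum_div, div_self (sum_exp_pos hK η L).ne']

/-- Increasing the cumulative losses by `x ≥ 0` decreases the weights at most by the factor
`1 - η x`. -/
theorem expWeights_sub_le (hK : 0 < K) {η : ℝ} (hη : 0 ≤ η) (L x : Fin K → ℝ) (hx : ∀ i, 0 ≤ x i)
    (i : Fin K) :
    expWeights η L i - expWeights η (fun j => L j + x j) i ≤ η * expWeights η L i * x i := by
  -- The numerator acquires exactly this factor, while the normalising sum can only shrink.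
  have h1 : expWeights η L i * Real.exp (-η * x i) ≤ expWeights η (fun j => L j + x j) i := by
    rw [expWeights, expWeights, div_mul_eq_mul_div, ← Real.exp_add, ← mul_add]
    refine div_le_div_of_nonneg_left (Real.exp_pos _).le (sum_exp_pos hK _ _) ?_
    refine Finset.sum_le_sum fun j _ => Real.exp_le_exp.2 ?_
    nlinarith [mul_nonneg hη (hx j)]
  have h2 := Real.add_one_le_exp (-η * x i)
  have h3 := (expWeights_pos hK η L i).le
  nlinarith [mul_le_mul_of_nonneg_left h2 h3]

/-- The potential of exponential weights. -/
noncomputable def potential (η : ℝ) (L : Fin K → ℝ) : ℝ :=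
  -(1 / η) * Real.log ((1 / K : ℝ) * ∑ j, Real.exp (-η * L j))

theorem potential_zero (hK : 0 < K) (η : ℝ) : potential η (fun _ : Fin K => 0) = 0 := by
  have : (K : ℝ) ≠ 0 := by positivity
  simp [potential, this]

theorem potential_le (hK : 0 < K) {η : ℝ} (hη : 0 < η) (L : Fin K → ℝ) (i : Fin K) :
    potential η L ≤ L i + Real.log K / η := by
  have hK' : (0 : ℝ) < K := by positivity
  have h1 : (1 / K : ℝ) * Real.exp (-η * L i) ≤ (1 / K : ℝ) * ∑ j, Real.exp (-η * L j) :=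
    mul_le_mul_of_nonneg_left (Finset.single_le_sum (f := fun j => Real.exp (-η * L j))
      (fun _ _ => (Real.exp_pos _).le) (Finset.mem_univ i)) (by positivity)
  have h2 := Real.log_le_log (by positivity) h1
  rw [Real.log_mul (by positivity) (Real.exp_pos _).ne', Real.log_exp, one_div, Real.log_inv] at h2
  rw [potential, one_div, one_div]
  have h3 := mul_le_mul_of_nonneg_left h2 (inv_pos.2 hη).le
  have : η⁻¹ * (-Real.log K + -η * L i) = -(L i + Real.log K / η) := by
    field_simp
    ring
  linarith

/-- The power mean inequality with exponent `η / η' ≥ 1`. It is what allows the step size to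
decrease between rounds. -/
theorem potential_antitone (hK : 0 < K) {η η' : ℝ} (hη' : 0 < η') (h : η' ≤ η) (L : Fin K → ℝ) :
    potential η L ≤ potential η' L := by
  have hK' : (0 : ℝ) < K := by positivity
  have hη : 0 < η := hη'.trans_le h
  have key := Real.rpow_arith_mean_le_arith_mean_rpow Finset.univ (fun _ : Fin K => (1 / K : ℝ))
    (fun j => Real.exp (-η' * L j)) (fun _ _ => by positivity)
    (by simp [hK'.ne']) (fun _ _ => (Real.exp_pos _).le) ((one_le_div hη').2 h)
  have e : ∀ j, Real.exp (-η' * L j) ^ (η / η') = Real.exp (-η * L j) := by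
    intro j
    rw [← Real.exp_mul]
    congr 1
    field_simp
  simp only [e, ← Finset.mul_sum] at key
  have hpos : ∀ x, 0 < (1 / K : ℝ) * ∑ j, Real.exp (-x * L j) := fun x =>
    mul_pos (by positivity) (sum_exp_pos hK x L)
  have h2 := Real.log_le_log (Real.rpow_pos_of_pos (hpos η') _) key
  rw [Real.log_rpow (hpos η')] at h2
  simp only [potential]
  have h3 := mul_le_mul_of_nonneg_left h2 (inv_pos.2 hη).le
  have h4 : η⁻¹ * (η / η' * Real.log ((1 / K : ℝ) * ∑ j, Real.exp (-η' * L j))) =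
      1 / η' * Real.log ((1 / K : ℝ) * ∑ j, Real.exp (-η' * L j)) := by
    field_simp
  rw [h4, ← one_div] at h3
  linarith

/-- Under the weights after the update, the mean of `exp (η g)` is exactly the ratio of the old to
the new normalising sum, so Jensen's inequality suffices. -/
theorem inner_le_potential_sub (hK : 0 < K) {η : ℝ} (hη : 0 < η) (L g : Fin K → ℝ) :
    ∑ i, expWeights η (fun j => L j + g j) i * g i ≤
      potential η (fun j => L j + g j) - potential η L := by
  have hK' : (0 : ℝ) < K := by positivity
  set q := expWeights η (fun j => L j + g j) with hq
  have h1 := convexOn_exp.map_sum_le (t := Finset.univ) (w := q) (p := fun i => η * g i)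
    (fun i _ => (expWeights_pos hK _ _ i).le) (sum_expWeights hK _ _) (fun _ _ => Set.mem_univ _)
  simp only [smul_eq_mul] at h1
  have h2 : ∑ i, q i * Real.exp (η * g i) =
      (∑ j, Real.exp (-η * L j)) / ∑ j, Real.exp (-η * (L j + g j)) := by
    rw [Finset.sum_div]
    refine Finset.sum_congr rfl fun i _ => ?_
    rw [hq, expWeights, div_mul_eq_mul_div, ← Real.exp_add]
    congr 2
    ring
  rw [h2] at h1
  have h3 := Real.log_le_log (Real.exp_pos _) h1
  have hs := sum_exp_pos hK η L
  have hs' := sum_exp_pos hK η fun j => L j + g j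
  rw [Real.log_exp, Real.log_div hs.ne' hs'.ne'] at h3
  have h4 : ∑ i, q i * (η * g i) = η * ∑ i, q i * g i := by
    rw [Finset.mul_sum]
    exact Finset.sum_congr rfl fun i _ => by ring
  rw [h4] at h3
  simp only [potential]
  rw [Real.log_mul (by positivity) hs.ne', Real.log_mul (by positivity) hs'.ne']
  have h5 := mul_le_mul_of_nonneg_left h3 (inv_pos.2 hη).le
  rw [inv_mul_cancel_left₀ hη.ne'] at h5
  rw [one_div]
  linarith

/-- The regret of the clairvoyant exponential weights forecaster, which also knows the loss of
the current round. -/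
theorem sum_inner_le (hK : 0 < K) {η : ℕ → ℝ} (hη : ∀ t, 1 ≤ t → 0 < η t)
    (hmono : ∀ t, 1 ≤ t → η (t + 1) ≤ η t) (g : ℕ → Fin K → ℝ) (T : ℕ) (hT : 1 ≤ T) (i : Fin K) :
    ∑ t ∈ Icc 1 T, ∑ j, expWeights (η t) (fun j => ∑ s ∈ Icc 1 t, g s j) j * g t j ≤
      ∑ t ∈ Icc 1 T, g t i + Real.log K / η T := by
  refine le_trans ?_ (potential_le hK (hη T hT) (fun j => ∑ s ∈ Icc 1 T, g s j) i)
  induction T, hT using Nat.le_induction with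
  | base =>
    have h := inner_le_potential_sub hK (hη 1 le_rfl) (fun _ => 0) (g 1)
    rw [potential_zero hK] at h
    simpa using h
  | succ T hT ih =>
    rw [Finset.sum_Icc_succ_top (by omega)]
    have h := inner_le_potential_sub hK (hη (T + 1) (by omega))
      (fun j => ∑ s ∈ Icc 1 T, g s j) (g (T + 1))
    have h' := potential_antitone hK (hη (T + 1) (by omega)) (hmono T hT)
      (fun j => ∑ s ∈ Icc 1 T, g s j)
    simp only [Finset.sum_Icc_succ_top (show 1 ≤ T + 1 by omega)]
    linarith

end ExpWeights

/-! ### Elementary inequalities. -/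

section Analysis

/-- The sum `∑ (X_t - X_{t-1}) / √X_t` is at most `2 √X_T`. -/
theorem sum_sqrt_div_mul_le {c : ℝ} (hc : 0 ≤ c) {X : ℕ → ℝ} (h0 : 0 ≤ X 0)
    (hpos : ∀ t, 1 ≤ t → 0 < X t) (T : ℕ) :
    ∑ t ∈ Icc 1 T, √(c / X t) * (X t - X (t - 1)) ≤ 2 * √(c * X T) := by
  induction T with
  | zero => simp
  | succ T ih =>
    rw [Finset.sum_Icc_succ_top (by omega), Nat.add_sub_cancel]
    have hT : 0 ≤ X T := by
      rcases Nat.eq_zero_or_pos T with rfl | h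
      · exact h0
      · exact (hpos T h).le
    have h1 := hpos (T + 1) (by omega)
    rw [Real.sqrt_div hc, Real.sqrt_mul hc]
    rw [Real.sqrt_mul hc] at ih
    have hs1 := Real.sqrt_pos.2 h1
    have : √c / √(X (T + 1)) * (X (T + 1) - X T) ≤ 2 * (√c * √(X (T + 1))) - 2 * (√c * √(X T)) := by
      rw [div_mul_eq_mul_div, div_le_iff₀ hs1]
      have e1 := Real.sq_sqrt h1.le
      have e2 := Real.sq_sqrt hT
      -- With `u = √X_{T+1}` and `v = √X_T`, this is `u² - v² ≤ 2 u (u - v)`.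
      have : 0 ≤ √c * (√(X (T + 1)) - √(X T)) ^ 2 := by positivity
      have e3 : √c * (X (T + 1) - X T) = √c * (√(X (T + 1)) ^ 2 - √(X T) ^ 2) := by rw [e1, e2]
      rw [e3]
      nlinarith
    linarith

/-- `exp` of an implicit exploration estimate is dominated by an importance weighted one. -/
theorem exp_implicit_le {β γ p l : ℝ} (hβ : 0 ≤ β) (hβγ : β ≤ 2 * γ) (hp : 0 < p) (hl0 : 0 ≤ l)
    (hl1 : l ≤ 1) : Real.exp (β * (l / (p + γ))) ≤ 1 + β * l / p := by
  have hγ : 0 ≤ γ := by linarith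
  have hbl : 0 ≤ β * l := mul_nonneg hβ hl0
  have hy : 0 ≤ β * l / p := by positivity
  rw [← Real.le_log_iff_exp_le (by positivity)]
  -- Through `log (1 + y) ≥ 2 y / (y + 2)` the claim becomes `β l ≤ 2 γ`.
  refine le_trans ?_ (Real.le_log_one_add_of_nonneg hy)
  have : 2 * (β * l / p) / (β * l / p + 2) = 2 * (β * l) / (β * l + 2 * p) := by
    field_simp
  rw [this, mul_div_assoc', div_le_div_iff₀ (by positivity) (by positivity)]
  have : β * l ≤ 2 * γ := by nlinarith
  nlinarith [mul_nonneg hbl (sub_nonneg.2 this)]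

/-- The graph lies below its chord, and `√e ≤ 5/3` because `e < 25/9`. This is the source of the
factors 2/3 and 4/3 in the deviation bounds. -/
theorem exp_half_mul_le {x : ℝ} (h0 : 0 ≤ x) (h1 : x ≤ 1) : Real.exp (x / 2) ≤ 1 + 2 / 3 * x := by
  have h := convexOn_exp.2 (Set.mem_univ 0) (Set.mem_univ (1 / 2 : ℝ)) (sub_nonneg.2 h1) h0
    (by ring)
  simp only [smul_eq_mul, mul_zero, zero_add, Real.exp_zero, mul_one] at h
  have h2 : Real.exp (1 / 2) ≤ 5 / 3 := by
    have h3 : Real.exp (1 / 2) ^ 2 = Real.exp 1 := by rw [← Real.exp_nat_mul]; norm_num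
    have := Real.exp_one_lt_d9
    have h4 := Real.exp_pos (1 / 2)
    nlinarith
  have h5 : x * (1 / 2) = x / 2 := by ring
  rw [h5] at h
  nlinarith

end Analysis

/-! ### The skipping rule: counted delays and the number of skipped rounds. -/

section Skipping

variable {K : ℕ} {d : ℕ → ℕ}

theorem mem_missing {s t : ℕ} : s ∈ missing d t ↔ 1 ≤ s ∧ s < t ∧ t ≤ s + d s := by
  simp [missing, and_assoc]

theorem counted_succ_le (K : ℕ) (d : ℕ → ℕ) (s t : ℕ) :
    counted K d s (t + 1) ≤ counted K d s t := by
  rw [counted_succ]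
  split_ifs <;> simp

theorem counted_antitone (K : ℕ) (d : ℕ → ℕ) (s : ℕ) : Antitone (counted K d s) :=
  antitone_nat_of_succ_le (counted_succ_le K d s)

theorem counted_le_one (K : ℕ) (d : ℕ → ℕ) (s t : ℕ) : counted K d s t ≤ 1 :=
  (counted_antitone K d s (Nat.zero_le t)).trans (counted_zero K d s).le

theorem counted_eq_one_of_le {s t t' : ℕ} (h : counted K d s t' = 1) (ht : t ≤ t') :
    counted K d s t = 1 :=
  le_antisymm (counted_le_one K d s t) (h ▸ counted_antitone K d s ht)

theorem counted_eq_one_of_le_succ {s t : ℕ} (h : t ≤ s + 1) : counted K d s t = 1 := by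
  induction t with
  | zero => exact counted_zero K d s
  | succ t ih =>
    rw [counted_succ, if_neg, ih (by omega)]
    rw [mem_missing]
    omega

theorem counted_eq_of_arrived {s t : ℕ} (h : s + d s < t) {t' : ℕ} (ht : t ≤ t') :
    counted K d s t' = counted K d s t := by
  induction t', ht using Nat.le_induction with
  | base => rfl
  | succ n hn ih =>
    rw [counted_succ, if_neg, ih]
    rw [mem_missing]
    omega

theorem sub_le_sqrt {s t : ℕ} (hs : s ∈ missing d t) (h : counted K d s (t + 1) = 1) :
    ((t - s : ℕ) : ℝ) ≤ √(cumCountedMissing K d t / Real.log K) := by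
  by_contra! hlt
  rw [counted_succ, if_pos] at h
  · simp at h
  · rw [min_eq_right (by have := mem_missing.1 hs; omega)]
    exact ⟨hs, hlt⟩

theorem sqrt_lt_sub {s t : ℕ} (h : counted K d s t = 1) (h' : counted K d s (t + 1) = 0) :
    s ∈ missing d t ∧ √(cumCountedMissing K d t / Real.log K) < ((t - s : ℕ) : ℝ) := by
  rw [counted_succ, h] at h'
  by_cases hc : s ∈ missing d t ∧
      √(cumCountedMissing K d t / Real.log K) < ((min (d s) (t - s) : ℕ) : ℝ)
  · refine ⟨hc.1, ?_⟩
    have h1 := hc.2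
    rwa [min_eq_right (by have := mem_missing.1 hc.1; omega)] at h1
  · rw [if_neg hc] at h'
    simp at h'

theorem cumCountedMissing_mono (K : ℕ) (d : ℕ → ℕ) : Monotone (cumCountedMissing K d) := by
  intro a b h
  exact Finset.sum_le_sum_of_subset (Finset.Icc_subset_Icc_right h)

theorem cumCountedMissing_zero : cumCountedMissing K d 0 = 0 := by simp [cumCountedMissing]

theorem cumCountedMissing_succ (t : ℕ) :
    cumCountedMissing K d (t + 1) = cumCountedMissing K d t + countedMissing K d (t + 1) := by
  rw [cumCountedMissing, Finset.sum_Icc_succ_top (by omega), cumCountedMissing]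

theorem sqrt_cumCountedMissing_mono (hK : 2 ≤ K) {s t : ℕ} (h : s ≤ t) :
    √(cumCountedMissing K d s / Real.log K) ≤ √(cumCountedMissing K d t / Real.log K) := by
  have : 0 < Real.log K := Real.log_pos (by exact_mod_cast hK)
  refine Real.sqrt_le_sqrt ?_
  gcongr
  exact cumCountedMissing_mono K d h

/-- The number of times up to `T` at which round `s` is missing and counted. -/
noncomputable def countedTime (K : ℕ) (d : ℕ → ℕ) (s T : ℕ) : ℕ :=
  ((Icc 1 T).filter fun t => s ∈ missing d t ∧ counted K d s t = 1).card

theorem countedTime_mono (K : ℕ) (d : ℕ → ℕ) (s : ℕ) : Monotone (countedTime K d s) := by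
  intro a b h
  exact Finset.card_le_card (Finset.filter_subset_filter _ (Finset.Icc_subset_Icc_right h))

theorem countedTime_le_delay (s T : ℕ) : countedTime K d s T ≤ d s := by
  have : ((Icc 1 T).filter fun t => s ∈ missing d t ∧ counted K d s t = 1) ⊆ Ioc s (s + d s) := by
    intro t ht
    have := mem_missing.1 (Finset.mem_filter.1 ht).2.1
    simp only [mem_Ioc]
    omega
  have h := Finset.card_le_card this
  rw [Nat.card_Ioc] at h
  rw [countedTime]
  omega

theorem countedTime_le (hK : 2 ≤ K) (s T : ℕ) :
    (countedTime K d s T : ℝ) ≤ 1 + √(cumCountedMissing K d T / Real.log K) := by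
  set U := (Icc 1 T).filter fun t => s ∈ missing d t ∧ counted K d s t = 1 with hU
  rcases U.eq_empty_or_nonempty with he | hne
  · rw [countedTime, ← hU, he]
    simp only [card_empty, Nat.cast_zero]
    positivity
  · have hmem := U.max'_mem hne
    obtain ⟨t₀, ht₀⟩ : ∃ t, t = U.max' hne := ⟨_, rfl⟩
    rw [← ht₀] at hmem
    rw [hU, Finset.mem_filter, mem_Icc, mem_missing] at hmem
    obtain ⟨⟨h1, h2⟩, ⟨h3, h4, h5⟩, h6⟩ := hmem
    have hsub : U ⊆ Ioc s t₀ := by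
      intro t ht
      have h7 := ht₀ ▸ U.le_max' t ht
      have h8 := mem_missing.1 (Finset.mem_filter.1 ht).2.1
      simp only [mem_Ioc]
      omega
    have hcard := Finset.card_le_card hsub
    rw [Nat.card_Ioc] at hcard
    -- Being counted at the last time `n + 1` only shows that the test was passed at time `n`, hence
    -- the additional 1 in the bound.
    obtain ⟨n, rfl⟩ : ∃ n, t₀ = n + 1 := ⟨t₀ - 1, by omega⟩
    rw [countedTime, ← hU]
    have h9 : ((n - s : ℕ) : ℝ) ≤ √(cumCountedMissing K d T / Real.log K) := by
      by_cases hs : s < n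
      · exact (sub_le_sqrt (mem_missing.2 ⟨h3, hs, by omega⟩) h6).trans
          (sqrt_cumCountedMissing_mono hK (by omega))
      · rw [Nat.sub_eq_zero_of_le (by omega)]
        simp only [Nat.cast_zero]
        positivity
    have h10 : (U.card : ℝ) ≤ 1 + ((n - s : ℕ) : ℝ) := by
      exact_mod_cast (by omega : U.card ≤ 1 + (n - s))
    linarith

theorem countedMissing_eq {t T : ℕ} (ht : t ≤ T) : countedMissing K d t =
    ∑ s ∈ Icc 1 T, if s ∈ missing d t ∧ counted K d s t = 1 then 1 else 0 := by
  rw [countedMissing]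
  have : missing d t = (Icc 1 T).filter fun s => s ∈ missing d t := by
    ext s
    simp only [Finset.mem_filter, mem_Icc, mem_missing]
    omega
  conv_lhs => rw [this]
  rw [Finset.sum_filter]
  refine Finset.sum_congr rfl fun s _ => ?_
  have := counted_le_one K d s t
  by_cases h : s ∈ missing d t <;> by_cases h' : counted K d s t = 1 <;> simp [h, h']
  omega

theorem cumCountedMissing_eq (T : ℕ) :
    cumCountedMissing K d T = ∑ s ∈ Icc 1 T, countedTime K d s T := by
  rw [cumCountedMissing]
  rw [Finset.sum_congr rfl fun t ht => countedMissing_eq (K := K) (d := d) (mem_Icc.1 ht).2,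
    Finset.sum_comm]
  refine Finset.sum_congr rfl fun s _ => ?_
  rw [countedTime, Finset.card_filter]

/-- Here `r = |R|` and `m - r = √(D_{R̄} log K)`. The worst case is `r = m = M`, `L = M / 2`, where
`Y² ≤ M² / 2 + M Y` forces `Y ≤ (1 + √3) / 2 · M < 7/5 M`. -/
theorem le_of_sq_le_of_split {r m M L Y : ℝ} (hr : 0 ≤ r) (hrm : r ≤ m) (hmM : m ≤ M)
    (hL : 2 * L ≤ M) (h : Y ^ 2 ≤ (m - r) ^ 2 + r * L + r * Y) :
    Y ≤ 7 / 5 * M := by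
  by_contra! hlt
  have h1 : (m - r) ^ 2 ≤ (M - r) ^ 2 := by
    apply pow_le_pow_left₀ <;> linarith
  have h2 : r * L ≤ r * (M / 2) := mul_le_mul_of_nonneg_left (by linarith) hr
  have h3 : 0 < (Y - 7 / 5 * M) * (Y + 7 / 5 * M - r) := by
    apply mul_pos <;> linarith
  have h4 : 0 ≤ (M - r) * (0.96 * M + r) := by
    apply mul_nonneg <;> linarith
  have h5 : 0 ≤ r * M := mul_nonneg hr (by linarith)
  nlinarith

theorem sqrt_cumCountedMissing_mul_le (hK : 2 ≤ K) (T : ℕ) :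
    √(cumCountedMissing K d T * Real.log K) ≤
      7 / 5 * max (2 * Real.log K) (bestSkip K T d) := by
  have hL : 0 < Real.log K := Real.log_pos (by exact_mod_cast hK)
  set D : ℝ := ((cumCountedMissing K d T : ℕ) : ℝ) with hD
  have hD0 : 0 ≤ D := by positivity
  obtain ⟨R, hR, hbest⟩ := Finset.exists_mem_eq_inf' (s := (Icc 1 T).powerset)
    ⟨∅, Finset.empty_mem_powerset _⟩ (fun R =>
    (R.card : ℝ) + √((∑ t ∈ Finset.Icc 1 T \ R, (d t : ℝ)) * Real.log K))
  rw [Finset.mem_powerset] at hR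
  have hbest' : bestSkip K T d =
    (R.card : ℝ) + √((∑ t ∈ Finset.Icc 1 T \ R, (d t : ℝ)) * Real.log K) := hbest
  set S : ℝ := ∑ t ∈ Finset.Icc 1 T \ R, (d t : ℝ)
  have hS0 : 0 ≤ S := by positivity
  have hb : √(D / Real.log K) * Real.log K = √(D * Real.log K) := by
    rw [Real.sqrt_div hD0, Real.sqrt_mul hD0, div_mul_eq_mul_div, mul_div_assoc,
      Real.div_sqrt]
  have hDle : D ≤ S + R.card * (1 + √(D / Real.log K)) := by
    have h1 : D = ∑ s ∈ Icc 1 T, (countedTime K d s T : ℝ) := by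
      rw [hD, cumCountedMissing_eq]
      push_cast
      rfl
    have h2 := Finset.sum_sdiff (f := fun s => (countedTime K d s T : ℝ)) hR
    have h3 : ∑ s ∈ Icc 1 T \ R, (countedTime K d s T : ℝ) ≤ S :=
      Finset.sum_le_sum fun s _ => by exact_mod_cast countedTime_le_delay s T
    have h4 : ∑ s ∈ R, (countedTime K d s T : ℝ) ≤ R.card * (1 + √(D / Real.log K)) := by
      rw [← nsmul_eq_mul]
      exact Finset.sum_le_card_nsmul _ _ _ fun s _ => countedTime_le hK s T
    linarith
  refine le_of_sq_le_of_split (r := R.card) (m := bestSkip K T d) (L := Real.log K) (by positivity)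
    ?_ (le_max_right _ _) (le_max_left _ _) ?_
  · rw [hbest']
    linarith [Real.sqrt_nonneg (S * Real.log K)]
  · rw [hbest', add_sub_cancel_left, Real.sq_sqrt (by positivity), Real.sq_sqrt (by positivity),
      ← hb]
    nlinarith

/-- The rounds that are never skipped. -/
noncomputable def kept (K : ℕ) (d : ℕ → ℕ) (T : ℕ) : Finset ℕ :=
  (Icc 1 T).filter fun s => counted K d s (T + 1) = 1

/-- The rounds skipped up to time `t`. -/
noncomputable def skipped (K : ℕ) (d : ℕ → ℕ) (t : ℕ) : Finset ℕ :=
  (Icc 1 t).filter fun s => counted K d s (t + 1) = 0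

theorem mem_kept {s T : ℕ} :
    s ∈ kept K d T ↔ (1 ≤ s ∧ s ≤ T) ∧ counted K d s (T + 1) = 1 := by
  simp [kept]

theorem mem_skipped {s t : ℕ} :
    s ∈ skipped K d t ↔ (1 ≤ s ∧ s ≤ t) ∧ counted K d s (t + 1) = 0 := by
  simp [skipped]

theorem sum_countedTime_skipped_le (t : ℕ) :
    ∑ s ∈ skipped K d t, countedTime K d s t ≤ cumCountedMissing K d t := by
  rw [cumCountedMissing_eq]
  exact Finset.sum_le_sum_of_subset (Finset.filter_subset _ _)

/-- With `y = 2 L q`, so `y² = 4 L c`, the hypotheses give `N² ≤ y² - 2 n y ≤ (y - n)²` and `n ≤ y /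
2`, so `N + n ≤ y`. The bound `n ≤ c` serves the case `q = 0`. -/
theorem add_sq_le_of_step {N n C c q L : ℝ} (hL : 0 < L) (hN : 0 ≤ N) (hn : 0 ≤ n) (hq : 0 ≤ q)
    (hc : c = q ^ 2 * L) (hNC : N ^ 2 ≤ 4 * L * C) (hstep : C + n * q ≤ c) (hnc : n ≤ c) :
    (N + n) ^ 2 ≤ 4 * L * c := by
  have hy : 4 * L * c = (2 * (L * q)) ^ 2 := by rw [hc]; ring
  have hLq : 0 ≤ L * q := by positivity
  rw [hy]
  apply pow_le_pow_left₀ (by positivity)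
  have h1 : N ^ 2 + 4 * (n * (L * q)) ≤ (2 * (L * q)) ^ 2 := by
    rw [← hy]
    nlinarith [mul_le_mul_of_nonneg_left hstep hL.le]
  rcases hLq.eq_or_lt with h0 | hpos
  · rw [← h0] at h1 ⊢
    have hq0 : q = 0 := by
      rcases mul_eq_zero.1 h0.symm with h | h
      · exact absurd h hL.ne'
      · exact h
    rw [hc, hq0] at hnc
    nlinarith
  · by_contra! hlt
    have h2 : n ≤ L * q := by
      by_contra! h
      nlinarith [mul_pos hpos (sub_pos.2 h), sq_nonneg N]
    have h3 : (2 * (L * q) - n) ^ 2 < N ^ 2 := by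
      apply pow_lt_pow_left₀ <;> linarith
    nlinarith [sq_nonneg n]

/-- Induction on time, with the counted time `c` of the skipped rounds in place of `D̃_t`. Each
newly skipped round adds more than `√(D̃ / log K) ≥ √(c / log K)` to it, so many skips force a large
`c`. -/
theorem card_skipped_sq_le (hK : 2 ≤ K) (t : ℕ) :
    ((skipped K d t).card : ℝ) ^ 2 ≤
      4 * Real.log K * (∑ s ∈ skipped K d t, countedTime K d s t : ℕ) := by
  have hL : 0 < Real.log K := Real.log_pos (by exact_mod_cast hK)
  induction t with
  | zero => simp [skipped]
  | succ t ih =>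
    have hsub : skipped K d t ⊆ skipped K d (t + 1) := by
      intro s hs
      rw [mem_skipped] at hs ⊢
      exact ⟨by omega, by have := counted_succ_le K d s (t + 1); omega⟩
    set New := skipped K d (t + 1) \ skipped K d t with hNew
    have hcard : (skipped K d (t + 1)).card = (skipped K d t).card + New.card := by
      rw [hNew, Finset.card_sdiff_of_subset hsub]
      have := Finset.card_le_card hsub
      omega
    set c := ∑ s ∈ skipped K d (t + 1), countedTime K d s (t + 1) with hc
    have hsum := Finset.sum_sdiff (f := fun s => countedTime K d s (t + 1)) hsub
    have hold : ∑ s ∈ skipped K d t, countedTime K d s t ≤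
        ∑ s ∈ skipped K d t, countedTime K d s (t + 1) :=
      Finset.sum_le_sum fun s _ => countedTime_mono K d s (Nat.le_succ t)
    have hnew : ∀ s ∈ New, √(cumCountedMissing K d (t + 1) / Real.log K) <
        countedTime K d s (t + 1) := by
      intro s hs
      rw [hNew, Finset.mem_sdiff, mem_skipped, mem_skipped] at hs
      obtain ⟨⟨⟨h1, h2⟩, h3⟩, h4⟩ := hs
      have h5 : counted K d s (t + 1) = 1 := by
        by_contra h5
        have h6 := counted_le_one K d s (t + 1)
        by_cases h7 : s ≤ t
        · exact h4 ⟨⟨h1, h7⟩, by omega⟩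
        · obtain rfl : s = t + 1 := by omega
          exact h5 (counted_eq_one_of_le_succ (Nat.le_succ _))
      obtain ⟨h6, h7⟩ := sqrt_lt_sub h5 h3
      refine h7.trans_le ?_
      have h8 : Ioc s (t + 1) ⊆ (Icc 1 (t + 1)).filter
          fun t' => s ∈ missing d t' ∧ counted K d s t' = 1 := by
        intro t' ht'
        rw [mem_missing] at h6
        rw [mem_Ioc] at ht'
        rw [Finset.mem_filter, mem_Icc, mem_missing]
        exact ⟨by omega, by omega, counted_eq_one_of_le h5 ht'.2⟩
      have h9 := Finset.card_le_card h8
      rw [Nat.card_Ioc] at h9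
      exact_mod_cast h9
    have hcD : (c : ℝ) ≤ cumCountedMissing K d (t + 1) := by
      exact_mod_cast sum_countedTime_skipped_le (K := K) (d := d) (t + 1)
    have hq : √(c / Real.log K) ≤ √(cumCountedMissing K d (t + 1) / Real.log K) := by
      apply Real.sqrt_le_sqrt
      gcongr
    have h1 : (New.card : ℝ) * √(c / Real.log K) ≤ ∑ s ∈ New, (countedTime K d s (t + 1) : ℝ) := by
      rw [← nsmul_eq_mul]
      exact Finset.card_nsmul_le_sum _ _ _ fun s hs => hq.trans (hnew s hs).le
    have h2 : (New.card : ℝ) * 1 ≤ ∑ s ∈ New, (countedTime K d s (t + 1) : ℝ) := by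
      rw [← nsmul_eq_mul]
      refine Finset.card_nsmul_le_sum _ _ _ fun s hs => ?_
      have := (Real.sqrt_nonneg _).trans_lt (hnew s hs)
      exact_mod_cast this
    have hsum' : ∑ s ∈ New, (countedTime K d s (t + 1) : ℝ) +
        ((∑ s ∈ skipped K d t, countedTime K d s (t + 1) : ℕ) : ℝ) = c := by
      rw [hc, ← hsum, ← hNew]
      push_cast
      rfl
    have hold' : ((∑ s ∈ skipped K d t, countedTime K d s t : ℕ) : ℝ) ≤
        ((∑ s ∈ skipped K d t, countedTime K d s (t + 1) : ℕ) : ℝ) := by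
      exact_mod_cast hold
    have hpos : (0 : ℝ) ≤ ((∑ s ∈ skipped K d t, countedTime K d s (t + 1) : ℕ) : ℝ) :=
      Nat.cast_nonneg _
    rw [hcard]
    push_cast only [Nat.cast_add]
    refine add_sq_le_of_step hL (Nat.cast_nonneg _) (Nat.cast_nonneg _)
      (Real.sqrt_nonneg (c / Real.log K)) ?_ ih ?_ ?_
    · rw [Real.sq_sqrt (by positivity)]
      field_simp
    · linarith
    · linarith

/-- The number of skipped rounds. -/
theorem card_skipped_le (hK : 2 ≤ K) (T : ℕ) :
    ((skipped K d T).card : ℝ) ≤ 2 * √(cumCountedMissing K d T * Real.log K) := by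
  have hL : 0 < Real.log K := Real.log_pos (by exact_mod_cast hK)
  have h1 := card_skipped_sq_le (d := d) hK T
  have h2 : ((∑ s ∈ skipped K d T, countedTime K d s T : ℕ) : ℝ) ≤ cumCountedMissing K d T := by
    exact_mod_cast sum_countedTime_skipped_le (K := K) (d := d) T
  refine abs_le_of_sq_le_sq' ?_ (by positivity) |>.2
  rw [mul_pow, Real.sq_sqrt (by positivity)]
  nlinarith

theorem card_missing_le (hK : 2 ≤ K) {s T : ℕ} (hs : s ∈ kept K d T) :
    (((Icc 1 T).filter fun t => s ∈ missing d t).card : ℝ) ≤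
      √(cumCountedMissing K d T / Real.log K) := by
  set U := (Icc 1 T).filter fun t => s ∈ missing d t with hU
  rcases U.eq_empty_or_nonempty with he | hne
  · rw [he]
    simp only [card_empty, Nat.cast_zero]
    positivity
  · have hmem := U.max'_mem hne
    obtain ⟨t₀, ht₀⟩ : ∃ t, t = U.max' hne := ⟨_, rfl⟩
    rw [← ht₀] at hmem
    rw [hU, Finset.mem_filter, mem_Icc] at hmem
    have hsub : U ⊆ Ioc s t₀ := by
      intro t ht
      have h7 := ht₀ ▸ U.le_max' t ht
      have h8 := mem_missing.1 (Finset.mem_filter.1 ht).2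
      simp only [mem_Ioc]
      omega
    have hcard := Finset.card_le_card hsub
    rw [Nat.card_Ioc] at hcard
    calc (U.card : ℝ) ≤ ((t₀ - s : ℕ) : ℝ) := by exact_mod_cast hcard
      _ ≤ √(cumCountedMissing K d t₀ / Real.log K) :=
        -- A kept round passes the test even at its last missing time, so no extra 1 appears here.
        sub_le_sqrt hmem.2 (counted_eq_one_of_le (mem_kept.1 hs).2 (by omega))
      _ ≤ _ := sqrt_cumCountedMissing_mono hK (by omega)

theorem card_missing_inter_kept_le {t T : ℕ} (ht : t ≤ T) :
    (missing d t ∩ kept K d T).card ≤ countedMissing K d t := by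
  rw [countedMissing, Finset.card_eq_sum_ones]
  refine (Finset.sum_le_sum fun s hs => ?_).trans
    (Finset.sum_le_sum_of_subset (Finset.inter_subset_left (s₂ := kept K d T)))
  rw [Finset.mem_inter, mem_kept] at hs
  exact (counted_eq_one_of_le hs.2.2 (by omega)).ge

/-- A used round has arrived, so its indicator is frozen at 1 and it is kept; the other kept rounds
before `t` are missing. -/
theorem sum_kept_eq {t T : ℕ} (ht : t ≤ T) (f : ℕ → ℝ) :
    ∑ s ∈ Ico 1 t, (if s ∈ kept K d T then f s else 0) =
      ∑ s ∈ used K d t, f s + ∑ s ∈ missing d t ∩ kept K d T, f s := by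
  rw [← Finset.sum_union, ← Finset.sum_filter]
  · congr 1
    ext s
    simp only [Finset.mem_filter, mem_Ico, Finset.mem_union, used, Finset.mem_inter, mem_missing,
      mem_kept]
    constructor
    · rintro ⟨h1, h2, h3⟩
      by_cases h : s + d s < t
      · exact Or.inl ⟨h1, h, counted_eq_one_of_le h3 (by omega)⟩
      · exact Or.inr ⟨⟨h1.1, h1.2, by omega⟩, h2, h3⟩
    · rintro (⟨h1, h2, h3⟩ | ⟨h1, h2, h3⟩)
      · exact ⟨h1, by omega, by rw [counted_eq_of_arrived h2 (by omega), h3]⟩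
      · exact ⟨by omega, h2, h3⟩
  · rw [Finset.disjoint_left]
    intro s hs hs'
    simp only [Finset.mem_filter, used, Finset.mem_inter, mem_missing] at hs hs'
    omega

theorem sum_eq_sum_kept_add (T : ℕ) (f : ℕ → ℝ) :
    ∑ t ∈ Icc 1 T, f t = ∑ t ∈ kept K d T, f t + ∑ t ∈ skipped K d T, f t := by
  rw [← Finset.sum_union]
  · congr 1
    ext s
    have := counted_le_one K d s (T + 1)
    simp only [mem_Icc, Finset.mem_union, mem_kept, mem_skipped]
    omega
  · rw [Finset.disjoint_left]
    intro s hs hs'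
    rw [mem_kept] at hs
    rw [mem_skipped] at hs'
    omega

end Skipping

/-! ### Loss estimates and the pathwise regret bound on kept rounds. -/

section Estimates

variable {K : ℕ} {ℓ : ℕ → Fin K → ℝ} {d : ℕ → ℕ} {η γ : ℕ → ℝ}

/-- The estimate of a used round `s` also involves `p_s`, which rests on rounds that arrived before
`s < t`. This dependence structure permits sampling in arrival order. -/
theorem distr_congr {a b : ℕ → Fin K} (t : ℕ) (h : ∀ s, s + d s < t → a s = b s) :
    distr ℓ d η γ a t = distr ℓ d η γ b t := by
  induction t using Nat.strong_induction_on with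
  | _ t ih =>
    rw [distr_eq, distr_eq]
    congr 1
    funext i
    refine Finset.sum_congr rfl fun s hs => ?_
    simp only [used, Finset.mem_filter, mem_Ico] at hs
    rw [ih s hs.1.2 fun r hr => h r (by omega), h s hs.2.1]

theorem distr_update {r t : ℕ} (h : t ≤ r + d r) (a : ℕ → Fin K) (i : Fin K) :
    distr ℓ d η γ (update a r i) t = distr ℓ d η γ a t :=
  distr_congr t fun s hs => update_of_ne (by rintro rfl; omega) _ _

theorem distr_pos (hK : 0 < K) (a : ℕ → Fin K) (t : ℕ) (i : Fin K) : 0 < distr ℓ d η γ a t i := by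
  rw [distr_eq]
  exact expWeights_pos hK _ _ _

theorem sum_distr (hK : 0 < K) (a : ℕ → Fin K) (t : ℕ) : ∑ i, distr ℓ d η γ a t i = 1 := by
  rw [distr_eq]
  exact sum_expWeights hK _ _

theorem distr_le_one (hK : 0 < K) (a : ℕ → Fin K) (t : ℕ) (i : Fin K) :
    distr ℓ d η γ a t i ≤ 1 := by
  rw [← sum_distr hK a t]
  exact Finset.single_le_sum (f := fun i => distr ℓ d η γ a t i)
    (fun j _ => (distr_pos hK a t j).le) (Finset.mem_univ i)

variable (ℓ d η γ) in
/-- The loss estimates along the path `a`. -/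
noncomputable def pathEstimate (a : ℕ → Fin K) (s : ℕ) (i : Fin K) : ℝ :=
  lossEstimate (γ s) (ℓ s) (distr ℓ d η γ a s) (a s) i

variable (ℓ d η γ) in
/-- The quotient `ℓ_{t,i} / (p_{t,i} + γ_t)`. -/
noncomputable def weightedLoss (a : ℕ → Fin K) (t : ℕ) (i : Fin K) : ℝ :=
  ℓ t i / (distr ℓ d η γ a t i + γ t)

theorem pathEstimate_eq (a : ℕ → Fin K) (s : ℕ) (i : Fin K) :
    pathEstimate ℓ d η γ a s i = if a s = i then weightedLoss ℓ d η γ a s i else 0 := by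
  rw [pathEstimate, lossEstimate, weightedLoss]
  split_ifs <;> simp

theorem weightedLoss_update {r t : ℕ} (h : t ≤ r + d r) (a : ℕ → Fin K) (i : Fin K) :
    weightedLoss ℓ d η γ (update a r i) t = weightedLoss ℓ d η γ a t := by
  funext j
  rw [weightedLoss, weightedLoss, distr_update h]

theorem pathEstimate_update {r s : ℕ} (hrs : s ≠ r) (h : s ≤ r + d r) (a : ℕ → Fin K)
    (i : Fin K) : pathEstimate ℓ d η γ (update a r i) s = pathEstimate ℓ d η γ a s := by
  funext j
  rw [pathEstimate_eq, pathEstimate_eq, weightedLoss_update h, update_of_ne hrs]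

theorem pathEstimate_update_self (s : ℕ) (a : ℕ → Fin K) (i j : Fin K) :
    pathEstimate ℓ d η γ (update a s j) s i =
      if j = i then weightedLoss ℓ d η γ a s i else 0 := by
  rw [pathEstimate_eq, weightedLoss_update (Nat.le_add_right _ _), update_self]

theorem weightedLoss_nonneg (hK : 0 < K) {s : ℕ} (hℓ : ∀ i, ℓ s i ∈ Set.Icc (0 : ℝ) 1)
    (hγ : 0 ≤ γ s) (a : ℕ → Fin K) (i : Fin K) : 0 ≤ weightedLoss ℓ d η γ a s i :=
  div_nonneg (hℓ i).1 (add_nonneg (distr_pos hK a s i).le hγ)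

theorem pathEstimate_nonneg (hK : 0 < K) {s : ℕ} (hℓ : ∀ i, ℓ s i ∈ Set.Icc (0 : ℝ) 1)
    (hγ : 0 ≤ γ s) (a : ℕ → Fin K) (i : Fin K) : 0 ≤ pathEstimate ℓ d η γ a s i := by
  rw [pathEstimate_eq]
  split_ifs
  · exact weightedLoss_nonneg hK hℓ hγ a i
  · exact le_rfl

theorem add_mul_weightedLoss (hK : 0 < K) {s : ℕ} (hγ : 0 ≤ γ s) (a : ℕ → Fin K) (i : Fin K) :
    (distr ℓ d η γ a s i + γ s) * weightedLoss ℓ d η γ a s i = ℓ s i :=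
  mul_div_cancel₀ _ (add_pos_of_pos_of_nonneg (distr_pos hK a s i) hγ).ne'

theorem distr_mul_weightedLoss_le (hK : 0 < K) {s : ℕ} (hℓ : ∀ i, ℓ s i ∈ Set.Icc (0 : ℝ) 1)
    (hγ : 0 ≤ γ s) (a : ℕ → Fin K) (i : Fin K) :
    distr ℓ d η γ a s i * weightedLoss ℓ d η γ a s i ≤ ℓ s i := by
  have h1 := add_mul_weightedLoss (ℓ := ℓ) (d := d) (η := η) hK hγ a i
  have h2 := mul_nonneg hγ (weightedLoss_nonneg (d := d) (η := η) hK hℓ hγ a i)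
  linarith

theorem sum_mul_pathEstimate (q : Fin K → ℝ) (a : ℕ → Fin K) (s : ℕ) :
    ∑ i, q i * pathEstimate ℓ d η γ a s i = q (a s) * weightedLoss ℓ d η γ a s (a s) := by
  simp [pathEstimate_eq]

theorem sum_distr_mul_pathEstimate_update (s : ℕ) (a : ℕ → Fin K) (i : Fin K) :
    ∑ j, distr ℓ d η γ a s j * pathEstimate ℓ d η γ (update a s j) s i =
      distr ℓ d η γ a s i * weightedLoss ℓ d η γ a s i := by
  simp [pathEstimate_update_self]

variable (ℓ d η γ) in
/-- The sum of the estimates of the rounds that are missing at time `t` and never skipped. -/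
noncomputable def missingEstimate (T : ℕ) (a : ℕ → Fin K) (t : ℕ) (i : Fin K) : ℝ :=
  ∑ s ∈ missing d t ∩ kept K d T, pathEstimate ℓ d η γ a s i

theorem missingEstimate_nonneg (hK : 0 < K) {T : ℕ}
    (hℓ : ∀ t ∈ Finset.Icc 1 T, ∀ i, ℓ t i ∈ Set.Icc (0 : ℝ) 1) (hγ : ∀ t, 0 ≤ γ t)
    (a : ℕ → Fin K) (t : ℕ) (i : Fin K) : 0 ≤ missingEstimate ℓ d η γ T a t i := by
  refine Finset.sum_nonneg fun s hs => pathEstimate_nonneg hK (hℓ s ?_) (hγ s) a i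
  exact (Finset.mem_filter.1 (Finset.mem_inter.1 hs).2).1

theorem missingEstimate_update {T t r : ℕ} (h : t ≤ r) (a : ℕ → Fin K) (i : Fin K) :
    missingEstimate ℓ d η γ T (update a r i) t = missingEstimate ℓ d η γ T a t := by
  funext j
  refine Finset.sum_congr rfl fun s hs => ?_
  have := mem_missing.1 (Finset.mem_inter.1 hs).1
  rw [pathEstimate_update (by omega) (by omega)]

variable (ℓ d η γ) in
/-- The excess of the loss of round `t` over the loss of the clairvoyant forecaster is bounded
by this quantity. -/
noncomputable def drift (T : ℕ) (a : ℕ → Fin K) (t : ℕ) : ℝ :=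
  γ t * weightedLoss ℓ d η γ a t (a t) +
    η t * (distr ℓ d η γ a t (a t) * weightedLoss ℓ d η γ a t (a t)) *
      (weightedLoss ℓ d η γ a t (a t) + missingEstimate ℓ d η γ T a t (a t))

variable (ℓ d η γ) in
/-- A bound on the conditional mean of `drift`. -/
noncomputable def meanDrift (T : ℕ) (a : ℕ → Fin K) (t : ℕ) : ℝ :=
  (γ t + η t) * K + η t * ∑ j, distr ℓ d η γ a t j * missingEstimate ℓ d η γ T a t j

variable {T : ℕ}

theorem drift_nonneg (hK : 0 < K)
    (hℓ : ∀ t ∈ Finset.Icc 1 T, ∀ i, ℓ t i ∈ Set.Icc (0 : ℝ) 1) (hγ : ∀ t, 0 ≤ γ t)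
    (hη : ∀ t, 0 ≤ η t) (a : ℕ → Fin K) {t : ℕ} (ht : t ∈ Icc 1 T) :
    0 ≤ drift ℓ d η γ T a t := by
  have h1 := weightedLoss_nonneg (d := d) (η := η) hK (hℓ t ht) (hγ t) a (a t)
  have h2 := missingEstimate_nonneg (d := d) (η := η) hK hℓ hγ a t (a t)
  have h3 := (distr_pos (ℓ := ℓ) (d := d) (η := η) (γ := γ) hK a t (a t)).le
  have h4 := hγ t
  have h5 := hη t
  rw [drift]
  positivity

theorem sum_distr_mul_drift_le (hK : 0 < K)
    (hℓ : ∀ t ∈ Finset.Icc 1 T, ∀ i, ℓ t i ∈ Set.Icc (0 : ℝ) 1) (hγ : ∀ t, 0 ≤ γ t)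
    (hη : ∀ t, 0 ≤ η t) (a : ℕ → Fin K) {t : ℕ} (ht : t ∈ Icc 1 T) :
    ∑ j, distr ℓ d η γ a t j * drift ℓ d η γ T (update a t j) t ≤ meanDrift ℓ d η γ T a t := by
  have hsum : meanDrift ℓ d η γ T a t = ∑ j : Fin K, (γ t + η t +
      η t * (distr ℓ d η γ a t j * missingEstimate ℓ d η γ T a t j)) := by
    rw [meanDrift, Finset.sum_add_distrib, Finset.mul_sum]
    simp only [sum_const, card_univ, Fintype.card_fin, nsmul_eq_mul]
    ring
  rw [hsum]
  refine Finset.sum_le_sum fun j _ => ?_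
  rw [drift, update_self, weightedLoss_update (Nat.le_add_right _ _),
    distr_update (Nat.le_add_right _ _), missingEstimate_update le_rfl]
  have h1 := weightedLoss_nonneg (d := d) (η := η) hK (hℓ t ht) (hγ t) a j
  have h2 := missingEstimate_nonneg (d := d) (η := η) hK hℓ hγ a t j
  have h3 := (distr_pos (ℓ := ℓ) (d := d) (η := η) (γ := γ) hK a t j).le
  have h4 := (distr_mul_weightedLoss_le (d := d) (η := η) hK (hℓ t ht) (hγ t) a j).trans
    (hℓ t ht j).2
  set p := distr ℓ d η γ a t j
  set w := weightedLoss ℓ d η γ a t j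
  set m := missingEstimate ℓ d η γ T a t j
  have h0 : 0 ≤ p * w := mul_nonneg h3 h1
  have e1 : γ t * (p * w) ≤ γ t := mul_le_of_le_one_right (hγ t) h4
  have e2 : η t * ((p * w) * (p * w)) ≤ η t :=
    mul_le_of_le_one_right (hη t) (mul_le_one₀ h4 h0 h4)
  have e3 : η t * ((p * w) * (p * m)) ≤ η t * (p * m) :=
    mul_le_mul_of_nonneg_left (mul_le_of_le_one_left (mul_nonneg h3 h2) h4) (hη t)
  calc p * (γ t * w + η t * (p * w) * (w + m))
      = γ t * (p * w) + η t * ((p * w) * (p * w)) + η t * ((p * w) * (p * m)) := by ring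
    _ ≤ _ := by linarith

/-- The pathwise regret bound on the rounds that are never skipped. -/
theorem sum_kept_le (hK : 0 < K)
    (hℓ : ∀ t ∈ Finset.Icc 1 T, ∀ i, ℓ t i ∈ Set.Icc (0 : ℝ) 1) (hγ : ∀ t, 0 ≤ γ t)
    (hη0 : ∀ t, 0 ≤ η t) (hη : ∀ t, 1 ≤ t → 0 < η t) (hmono : ∀ t, 1 ≤ t → η (t + 1) ≤ η t)
    (hT : 1 ≤ T) (a : ℕ → Fin K) (i : Fin K) :
    ∑ t ∈ kept K d T, ℓ t (a t) ≤ ∑ t ∈ kept K d T, pathEstimate ℓ d η γ a t i +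
      Real.log K / η T + ∑ t ∈ kept K d T, min 1 (drift ℓ d η γ T a t) := by
  set g : ℕ → Fin K → ℝ := fun t j => if t ∈ kept K d T then pathEstimate ℓ d η γ a t j else 0
  have hsub : kept K d T ⊆ Icc 1 T := Finset.filter_subset _ _
  have hsum : ∀ f : ℕ → ℝ, ∑ t ∈ Icc 1 T, (if t ∈ kept K d T then f t else 0) =
      ∑ t ∈ kept K d T, f t := by
    intro f
    rw [← Finset.sum_filter, Finset.filter_mem_eq_inter, Finset.inter_eq_right.2 hsub]
  have h1 := sum_inner_le hK hη hmono g T hT i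
  rw [hsum] at h1
  have e : ∀ t ∈ Icc 1 T,
      ∑ j, expWeights (η t) (fun j => ∑ s ∈ Icc 1 t, g s j) j * g t j =
      if t ∈ kept K d T then
        expWeights (η t) (fun j => ∑ s ∈ Icc 1 t, g s j) (a t) *
          weightedLoss ℓ d η γ a t (a t) else 0 := by
    intro t _
    by_cases h : t ∈ kept K d T
    · simp only [g, h, if_true]
      rw [sum_mul_pathEstimate]
    · simp [g, h]
  rw [Finset.sum_congr rfl e, hsum] at h1
  suffices h : ∀ t ∈ kept K d T, ℓ t (a t) ≤
      expWeights (η t) (fun j => ∑ s ∈ Icc 1 t, g s j) (a t) *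
          weightedLoss ℓ d η γ a t (a t) + min 1 (drift ℓ d η γ T a t) by
    have h2 := Finset.sum_le_sum h
    rw [Finset.sum_add_distrib] at h2
    linarith
  intro t ht
  have htT := hsub ht
  have hw := weightedLoss_nonneg (d := d) (η := η) hK (hℓ t htT) (hγ t) a (a t)
  rw [← sub_le_iff_le_add']
  -- The bound 1 is trivial since losses are at most 1; it keeps the drift bounded for the
  -- exponential moment.
  refine le_min ?_ ?_
  · have h2 := mul_nonneg (expWeights_pos hK (η t) (fun j => ∑ s ∈ Icc 1 t, g s j) (a t)).le hw
    linarith [(hℓ t htT (a t)).2]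
  · have hL : (fun j => ∑ s ∈ Icc 1 t, g s j) = fun j =>
        ∑ s ∈ used K d t, pathEstimate ℓ d η γ a s j +
          (missingEstimate ℓ d η γ T a t j + pathEstimate ℓ d η γ a t j) := by
      funext j
      have hI : Icc 1 t = insert t (Ico 1 t) := by
        rw [mem_Icc] at htT
        ext s
        simp only [mem_Icc, mem_insert, mem_Ico]
        omega
      rw [hI, Finset.sum_insert (by simp), sum_kept_eq (mem_Icc.1 htT).2, missingEstimate]
      simp only [g, ht, if_true]
      ring
    have h2 := expWeights_sub_le hK (hη0 t)
      (fun j => ∑ s ∈ used K d t, pathEstimate ℓ d η γ a s j)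
      (fun j => missingEstimate ℓ d η γ T a t j + pathEstimate ℓ d η γ a t j)
      (fun j => add_nonneg (missingEstimate_nonneg hK hℓ hγ a t j)
        (pathEstimate_nonneg hK (hℓ t htT) (hγ t) a j)) (a t)
    rw [← hL] at h2
    have hd : expWeights (η t) (fun j => ∑ s ∈ used K d t, pathEstimate ℓ d η γ a s j) =
        distr ℓ d η γ a t := (distr_eq ℓ d η γ a t).symm
    rw [hd, pathEstimate_eq, if_pos rfl] at h2
    have h3 := mul_le_mul_of_nonneg_right h2 hw
    -- With `ℓ = (p + γ) w` and clairvoyant weight `q`, the excess `ℓ - q w` equals `γ w + (p - q)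
    -- w`.
    rw [drift, ← add_mul_weightedLoss (ℓ := ℓ) (d := d) (η := η) hK (hγ t) a (a t)]
    nlinarith

end Estimates

/-! ### Exponential moments of the deviations. -/

section Moments

variable {K : ℕ} {ℓ : ℕ → Fin K → ℝ} {d : ℕ → ℕ} {η γ : ℕ → ℝ} {T : ℕ} {i₀ : Fin K}

/-- Only the drawn action has a nonzero estimate, so the weights may vary with the action. Averaging
`1 + β_j ℓ_j / p_j` gives `1 + ∑ β_i ℓ_i`, which the exponential of the subtracted mean absorbs. -/
theorem sum_mul_exp_estimate_le (hK : 0 < K) {s : ℕ}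
    (hℓ : ∀ i, ℓ s i ∈ Set.Icc (0 : ℝ) 1) (a : ℕ → Fin K) (β : Fin K → ℝ)
    (hβ0 : ∀ i, 0 ≤ β i) (hβ : ∀ i, β i ≤ 2 * γ s) :
    ∑ j, distr ℓ d η γ a s j *
      Real.exp (∑ i, β i * (pathEstimate ℓ d η γ (update a s j) s i - ℓ s i)) ≤ 1 := by
  have e : ∀ j, Real.exp (∑ i, β i * (pathEstimate ℓ d η γ (update a s j) s i - ℓ s i)) =
      Real.exp (β j * weightedLoss ℓ d η γ a s j) * Real.exp (-∑ i, β i * ℓ s i) := by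
    intro j
    rw [← Real.exp_add]
    congr 1
    simp only [mul_sub, Finset.sum_sub_distrib, pathEstimate_update_self]
    simp [sub_eq_add_neg]
  simp only [e, ← mul_assoc]
  rw [← Finset.sum_mul]
  have h1 : ∑ j, distr ℓ d η γ a s j * Real.exp (β j * weightedLoss ℓ d η γ a s j) ≤
      1 + ∑ i, β i * ℓ s i := by
    rw [← sum_distr (ℓ := ℓ) (d := d) (η := η) (γ := γ) hK a s, ← Finset.sum_add_distrib]
    refine Finset.sum_le_sum fun j _ => ?_
    have hp := distr_pos (ℓ := ℓ) (d := d) (η := η) (γ := γ) hK a s j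
    refine (mul_le_mul_of_nonneg_left
      (exp_implicit_le (hβ0 j) (hβ j) hp (hℓ j).1 (hℓ j).2) hp.le).trans_eq ?_
    field_simp
  have h2 := Real.add_one_le_exp (∑ i, β i * ℓ s i)
  calc _ ≤ Real.exp (∑ i, β i * ℓ s i) * Real.exp (-∑ i, β i * ℓ s i) :=
        mul_le_mul_of_nonneg_right (by linarith) (Real.exp_pos _).le
    _ = 1 := by rw [← Real.exp_add, add_neg_cancel, Real.exp_zero]

/-- Implicit exploration: weighted sums of the estimation errors have exponential moment at most
one, even if the weights depend on the feedback that arrived before. -/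
theorem pathExp_exp_estimate_le (hK : 0 < K)
    (hℓ : ∀ t ∈ Finset.Icc 1 T, ∀ i, ℓ t i ∈ Set.Icc (0 : ℝ) 1)
    (β : ℕ → (ℕ → Fin K) → Fin K → ℝ) (hβ0 : ∀ s a i, 0 ≤ β s a i)
    (hβ : ∀ s a i, β s a i ≤ 2 * γ s)
    (hβu : ∀ s r, s + d s ≤ r + d r → ∀ a i, β s (update a r i) = β s a) :
    pathExp i₀ (fun t a => distr ℓ d η γ a t) (Icc 1 T) (fun a => Real.exp
      (∑ s ∈ Icc 1 T, ∑ i, β s a i * (pathEstimate ℓ d η γ a s i - ℓ s i))) ≤ 1 := by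
  simp only [Real.exp_sum (Icc 1 T)]
  refine pathExp_prod_le_one (fun s => s + d s) _ (fun q a i => (distr_pos hK a q i).le)
    (fun q r h a i => distr_update (by omega) a i) (fun _ _ => (Real.exp_pos _).le)
    (fun q r hqr h a i => ?_) (fun q hq a => ?_)
  · rw [hβu q r h, pathEstimate_update hqr (by omega)]
  · simp only [hβu q q le_rfl]
    exact sum_mul_exp_estimate_le hK (hℓ q hq) a _ (hβ0 q a) (hβ q a)

theorem pathExp_exp_drift_le (hK : 0 < K)
    (hℓ : ∀ t ∈ Finset.Icc 1 T, ∀ i, ℓ t i ∈ Set.Icc (0 : ℝ) 1) (hγ : ∀ t, 0 ≤ γ t)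
    (hη : ∀ t, 0 ≤ η t) :
    pathExp i₀ (fun t a => distr ℓ d η γ a t) (Icc 1 T) (fun a => Real.exp
      (∑ t ∈ Icc 1 T, (min 1 (drift ℓ d η γ T a t) / 2 - 2 / 3 * meanDrift ℓ d η γ T a t))) ≤
      1 := by
  have hm : ∀ q r, q ≤ r → ∀ a i, meanDrift ℓ d η γ T (update a r i) q =
      meanDrift ℓ d η γ T a q := by
    intro q r h a i
    rw [meanDrift, meanDrift, missingEstimate_update h, distr_update (by omega)]
  simp only [Real.exp_sum (Icc 1 T)]
  refine pathExp_prod_le_one (fun s => s) _ (fun q a i => (distr_pos hK a q i).le)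
    (fun q r h a i => distr_update (by omega) a i) (fun _ _ => (Real.exp_pos _).le)
    (fun q r hqr h a i => ?_) (fun t ht a => ?_)
  · rw [hm q r h, drift, drift, update_of_ne hqr, weightedLoss_update (by omega),
      distr_update (by omega), missingEstimate_update h]
  · simp only [hm t t le_rfl, Real.exp_sub]
    have hp := fun j => (distr_pos (ℓ := ℓ) (d := d) (η := η) (γ := γ) hK a t j).le
    set v := meanDrift ℓ d η γ T a t
    simp only [mul_div_assoc']
    rw [← Finset.sum_div, div_le_one (Real.exp_pos _)]
    have h1 : ∑ j, distr ℓ d η γ a t j *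
        Real.exp (min 1 (drift ℓ d η γ T (update a t j) t) / 2) ≤
        1 + 2 / 3 * ∑ j, distr ℓ d η γ a t j * drift ℓ d η γ T (update a t j) t := by
      have e1 : 1 + 2 / 3 * ∑ j, distr ℓ d η γ a t j * drift ℓ d η γ T (update a t j) t =
          ∑ j, (distr ℓ d η γ a t j +
            2 / 3 * (distr ℓ d η γ a t j * drift ℓ d η γ T (update a t j) t)) := by
        rw [Finset.sum_add_distrib, sum_distr hK, Finset.mul_sum]
      rw [e1]
      refine Finset.sum_le_sum fun j _ => ?_
      have h0 := drift_nonneg (d := d) hK hℓ hγ hη (update a t j) ht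
      have h2 := exp_half_mul_le (le_min zero_le_one h0) (min_le_left _ _)
      have h3 := min_le_right 1 (drift ℓ d η γ T (update a t j) t)
      refine (mul_le_mul_of_nonneg_left (h2.trans (add_le_add_right
        (mul_le_mul_of_nonneg_left h3 (by norm_num)) 1)) (hp j)).trans_eq ?_
      ring
    have h2 := sum_distr_mul_drift_le (d := d) hK hℓ hγ hη a ht
    have h3 := Real.add_one_le_exp (2 / 3 * v)
    linarith

end Moments

/-! ### The bound in expectation. -/

section ExpectedRegret

variable {K : ℕ} {ℓ : ℕ → Fin K → ℝ} {d : ℕ → ℕ} {η γ : ℕ → ℝ} {T : ℕ} {i₀ : Fin K}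

/-- Drawing the action of round `t` anew, in the order of the decisions. -/
theorem pathExp_resample_decision (hK : 0 < K) {t : ℕ} (ht : t ∈ Icc 1 T) (f : (ℕ → Fin K) → ℝ)
    (hf : ∀ r, t < r → ∀ a i, f (update a r i) = f a) :
    pathExp i₀ (fun t a => distr ℓ d η γ a t) (Icc 1 T) f =
      pathExp i₀ (fun t a => distr ℓ d η γ a t) (Icc 1 T)
        (fun a => ∑ j, distr ℓ d η γ a t j * f (update a t j)) :=
  pathExp_resample (fun s => s) (fun q a => sum_distr hK a q)
    (fun q r h a i => distr_update (by omega) a i) ht f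
    (fun q hq h a i => hf q (by omega) a i)

/-- Drawing the action of round `s` anew, in the order in which the feedback arrives. -/
theorem pathExp_resample_arrival (hK : 0 < K) {s : ℕ} (hs : s ∈ Icc 1 T) (f : (ℕ → Fin K) → ℝ)
    (hf : ∀ r, r ≠ s → s + d s ≤ r + d r → ∀ a i, f (update a r i) = f a) :
    pathExp i₀ (fun t a => distr ℓ d η γ a t) (Icc 1 T) f =
      pathExp i₀ (fun t a => distr ℓ d η γ a t) (Icc 1 T)
        (fun a => ∑ j, distr ℓ d η γ a s j * f (update a s j)) :=
  pathExp_resample (fun s => s + d s) (fun q a => sum_distr hK a q)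
    (fun q r h a i => distr_update (by omega) a i) hs f hf

theorem pathExp_eq_const (hK : 0 < K) (c : ℝ) :
    pathExp i₀ (fun t a => distr ℓ d η γ a t) (Icc 1 T) (fun _ => c) = c :=
  pathExp_const (fun s => s) (fun q a => sum_distr hK a q)
    (fun q r h a i => distr_update (by omega) a i) c

theorem pathExp_estimate_le (hK : 0 < K)
    (hℓ : ∀ t ∈ Finset.Icc 1 T, ∀ i, ℓ t i ∈ Set.Icc (0 : ℝ) 1) (hγ : ∀ t, 0 ≤ γ t)
    {t : ℕ} (ht : t ∈ Icc 1 T) (i : Fin K) :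
    pathExp i₀ (fun t a => distr ℓ d η γ a t) (Icc 1 T) (fun a => pathEstimate ℓ d η γ a t i) ≤
      ℓ t i := by
  rw [pathExp_resample_decision hK ht _ fun r hr a j => by
    rw [pathEstimate_update (by omega) (by omega)], 
    ← pathExp_eq_const (i₀ := i₀) (T := T) (ℓ := ℓ) (d := d) (η := η) (γ := γ) hK (ℓ t i)]
  refine pathExp_mono (fun q a i => (distr_pos hK a q i).le) fun a => ?_
  rw [sum_distr_mul_pathEstimate_update]
  exact distr_mul_weightedLoss_le hK (hℓ t ht) (hγ t) a i

/-- Since `t ≤ s + d_s`, the distribution `p_t` does not see `A_s`. Redrawing `A_s` in arrival order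
turns the estimate into at most `ℓ_{s,i} ≤ 1`. -/
theorem pathExp_distr_mul_estimate_le (hK : 0 < K)
    (hℓ : ∀ t ∈ Finset.Icc 1 T, ∀ i, ℓ t i ∈ Set.Icc (0 : ℝ) 1) (hγ : ∀ t, 0 ≤ γ t)
    {s t : ℕ} (hs : s ∈ Icc 1 T) (hst : s ∈ missing d t) (i : Fin K) :
    pathExp i₀ (fun t a => distr ℓ d η γ a t) (Icc 1 T)
        (fun a => distr ℓ d η γ a t i * pathEstimate ℓ d η γ a s i) ≤
      pathExp i₀ (fun t a => distr ℓ d η γ a t) (Icc 1 T) (fun a => distr ℓ d η γ a t i) := by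
  have hts := (mem_missing.1 hst).2.2
  rw [pathExp_resample_arrival hK hs _ fun r hr h a j => by
    rw [pathEstimate_update hr.symm (by omega), distr_update (by omega)]]
  refine pathExp_mono (fun q a i => (distr_pos hK a q i).le) fun a => ?_
  simp only [distr_update hts]
  have h := (distr_mul_weightedLoss_le (d := d) (η := η) hK (hℓ s hs) (hγ s) a i).trans (hℓ s hs i).2
  have e : ∑ j, distr ℓ d η γ a s j *
      (distr ℓ d η γ a t i * pathEstimate ℓ d η γ (update a s j) s i) =
      distr ℓ d η γ a t i * (distr ℓ d η γ a s i * weightedLoss ℓ d η γ a s i) := by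
    rw [← sum_distr_mul_pathEstimate_update, Finset.mul_sum]
    exact Finset.sum_congr rfl fun j _ => by ring
  rw [e]
  exact mul_le_of_le_one_right (distr_pos hK a t i).le h

theorem pathExp_meanDrift_le (hK : 0 < K)
    (hℓ : ∀ t ∈ Finset.Icc 1 T, ∀ i, ℓ t i ∈ Set.Icc (0 : ℝ) 1) (hγ : ∀ t, 0 ≤ γ t)
    (hη : ∀ t, 0 ≤ η t) {t : ℕ} (ht : t ∈ Icc 1 T) :
    pathExp i₀ (fun t a => distr ℓ d η γ a t) (Icc 1 T) (fun a => meanDrift ℓ d η γ T a t) ≤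
      (γ t + η t) * K + η t * countedMissing K d t := by
  have hsum : pathExp i₀ (fun t a => distr ℓ d η γ a t) (Icc 1 T)
      (fun a => ∑ j, distr ℓ d η γ a t j * missingEstimate ℓ d η γ T a t j) ≤
      countedMissing K d t := by
    simp only [missingEstimate, Finset.mul_sum]
    rw [pathExp_sum]
    simp only [pathExp_sum]
    rw [Finset.sum_comm]
    have hle : ((missing d t ∩ kept K d T).card : ℝ) ≤ countedMissing K d t := by
      exact_mod_cast card_missing_inter_kept_le (mem_Icc.1 ht).2
    refine le_trans ?_ hle
    rw [← mul_one (#_ : ℝ), ← nsmul_eq_mul]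
    refine Finset.sum_le_card_nsmul _ _ _ fun s hs => ?_
    rw [Finset.mem_inter] at hs
    have hsT : s ∈ Icc 1 T := (Finset.mem_filter.1 hs.2).1
    -- Summed over `j`, each missing kept round contributes at most `∑ p_{t,j} = 1`.
    refine (Finset.sum_le_sum fun j _ => pathExp_distr_mul_estimate_le hK hℓ hγ hsT hs.1 j).trans ?_
    rw [← pathExp_sum]
    simp only [sum_distr hK]
    exact (pathExp_eq_const hK 1).le
  simp only [meanDrift]
  rw [pathExp_add, pathExp_eq_const hK, pathExp_const_mul]
  exact add_le_add_right (mul_le_mul_of_nonneg_left hsum (hη t)) _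

theorem pathExp_drift_le (hK : 0 < K)
    (hℓ : ∀ t ∈ Finset.Icc 1 T, ∀ i, ℓ t i ∈ Set.Icc (0 : ℝ) 1) (hγ : ∀ t, 0 ≤ γ t)
    (hη : ∀ t, 0 ≤ η t) {t : ℕ} (ht : t ∈ Icc 1 T) :
    pathExp i₀ (fun t a => distr ℓ d η γ a t) (Icc 1 T) (fun a => drift ℓ d η γ T a t) ≤
      (γ t + η t) * K + η t * countedMissing K d t := by
  rw [pathExp_resample_decision hK ht _ fun r hr a j => by
    rw [drift, drift, update_of_ne (by omega), weightedLoss_update (by omega),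
      distr_update (by omega), missingEstimate_update (by omega)]]
  exact (pathExp_mono (fun q a i => (distr_pos hK a q i).le)
    fun a => sum_distr_mul_drift_le hK hℓ hγ hη a ht).trans (pathExp_meanDrift_le hK hℓ hγ hη ht)

theorem sum_pathExp_sub_le (hK : 0 < K)
    (hℓ : ∀ t ∈ Finset.Icc 1 T, ∀ i, ℓ t i ∈ Set.Icc (0 : ℝ) 1) (hγ : ∀ t, 0 ≤ γ t)
    (hη0 : ∀ t, 0 ≤ η t) (hη : ∀ t, 1 ≤ t → 0 < η t) (hmono : ∀ t, 1 ≤ t → η (t + 1) ≤ η t)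
    (hT : 1 ≤ T) (i : Fin K) :
    ∑ t ∈ Icc 1 T, pathExp i₀ (fun t a => distr ℓ d η γ a t) (Icc 1 T) (fun a => ℓ t (a t)) -
        ∑ t ∈ Icc 1 T, ℓ t i ≤
      (skipped K d T).card + Real.log K / η T +
        ∑ t ∈ Icc 1 T, ((γ t + η t) * K + η t * countedMissing K d t) := by
  have hp0 : ∀ q (a : ℕ → Fin K) i, 0 ≤ distr ℓ d η γ a q i := fun q a i => (distr_pos hK a q i).le
  have hkT : kept K d T ⊆ Icc 1 T := Finset.filter_subset _ _
  have hkept : ∑ t ∈ kept K d T,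
      pathExp i₀ (fun t a => distr ℓ d η γ a t) (Icc 1 T) (fun a => ℓ t (a t)) ≤
      ∑ t ∈ kept K d T, ℓ t i + Real.log K / η T +
        ∑ t ∈ Icc 1 T, ((γ t + η t) * K + η t * countedMissing K d t) := by
    rw [← pathExp_sum]
    refine (pathExp_mono hp0 fun a => sum_kept_le hK hℓ hγ hη0 hη hmono hT a i).trans ?_
    rw [pathExp_add, pathExp_add, pathExp_eq_const hK, pathExp_sum, pathExp_sum]
    refine add_le_add (add_le_add_left (Finset.sum_le_sum fun t ht =>
      pathExp_estimate_le hK hℓ hγ (hkT ht) i) _) ?_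
    refine (Finset.sum_le_sum fun t ht => (pathExp_mono hp0 fun a => min_le_right _ _).trans
      (pathExp_drift_le hK hℓ hγ hη0 (hkT ht))).trans
      (Finset.sum_le_sum_of_subset_of_nonneg hkT fun t _ _ => ?_)
    have h1 := hγ t
    have h2 := hη0 t
    positivity
  have hskip : ∑ t ∈ skipped K d T,
      pathExp i₀ (fun t a => distr ℓ d η γ a t) (Icc 1 T) (fun a => ℓ t (a t)) ≤
      ∑ t ∈ skipped K d T, ℓ t i + (skipped K d T).card := by
    rw [Finset.card_eq_sum_ones, Nat.cast_sum, ← Finset.sum_add_distrib]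
    refine Finset.sum_le_sum fun t ht => ?_
    have htT : t ∈ Icc 1 T := (Finset.mem_filter.1 ht).1
    refine ((pathExp_mono hp0 fun a => (hℓ t htT (a t)).2).trans_eq
      (pathExp_eq_const hK 1)).trans ?_
    have := (hℓ t htT i).1
    push_cast
    linarith
  rw [sum_eq_sum_kept_add (K := K) (d := d), sum_eq_sum_kept_add (K := K) (d := d) T fun t => ℓ t i]
  linarith

theorem sqrt_add_le_sqrt_add_sqrt {x y : ℝ} (hx : 0 ≤ x) (hy : 0 ≤ y) : √(x + y) ≤ √x + √y := by
  rw [Real.sqrt_le_iff]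
  refine ⟨by positivity, ?_⟩
  nlinarith [Real.sq_sqrt hx, Real.sq_sqrt hy, Real.sqrt_nonneg x, Real.sqrt_nonneg y,
    mul_nonneg (Real.sqrt_nonneg x) (Real.sqrt_nonneg y)]

theorem div_sqrt_div {c x : ℝ} (hc : 0 < c) (hx : 0 < x) : c / √(c / x) = √(c * x) := by
  rw [div_eq_iff (by positivity), ← Real.sqrt_mul (by positivity)]
  have : c * x * (c / x) = c ^ 2 := by field_simp
  rw [this, Real.sqrt_sq hc.le]

/-- The sum of the step sizes, each weighted by the increment of the quantity below its root. -/
theorem sum_sqrt_mul_le (K : ℕ) (d : ℕ → ℕ) {c m : ℝ} (hc : 0 ≤ c) (hm : 0 < m) (T : ℕ) :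
    ∑ t ∈ Icc 1 T, √(c / (t * m + cumCountedMissing K d t)) * (m + countedMissing K d t) ≤
      2 * √(c * (T * m + cumCountedMissing K d T)) := by
  have h := sum_sqrt_div_mul_le hc (X := fun t => t * m + cumCountedMissing K d t)
    (by simp [cumCountedMissing_zero]) (fun t ht => by positivity) T
  refine le_trans (Finset.sum_le_sum fun t ht => ?_) h
  obtain ⟨n, rfl⟩ : ∃ n, t = n + 1 := ⟨t - 1, by have := (mem_Icc.1 ht).1; omega⟩
  refine mul_le_mul_of_nonneg_left (le_of_eq ?_) (Real.sqrt_nonneg _)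
  rw [Nat.add_sub_cancel, cumCountedMissing_succ]
  push_cast
  ring

theorem sqrt_div_cum_antitone (K : ℕ) (d : ℕ → ℕ) {c m : ℝ} (hc : 0 ≤ c) (hm : 0 < m) {s t : ℕ}
    (hs : 1 ≤ s) (hst : s ≤ t) :
    √(c / (t * m + cumCountedMissing K d t)) ≤ √(c / (s * m + cumCountedMissing K d s)) := by
  refine Real.sqrt_le_sqrt (div_le_div_of_nonneg_left hc (by positivity) ?_)
  have h1 : (cumCountedMissing K d s : ℝ) ≤ cumCountedMissing K d t := by
    exact_mod_cast cumCountedMissing_mono K d hst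
  have h2 : (s : ℝ) ≤ t := by exact_mod_cast hst
  have h3 := mul_le_mul_of_nonneg_right h2 hm.le
  linarith

open MeasureTheory in
theorem expected_regret_le (hK : 2 ≤ K) {Ω : Type*} [MeasurableSpace Ω] {μ : Measure Ω}
    [IsProbabilityMeasure μ] {A : ℕ → Ω → Fin K}
    (hℓ : ∀ t ∈ Finset.Icc 1 T, ∀ i, ℓ t i ∈ Set.Icc (0 : ℝ) 1)
    (h : IsRun μ T ℓ d (stepSize K d) (fun _ => 0) A) (i : Fin K) :
    (∑ t ∈ Finset.Icc 1 T, ∫ ω, ℓ t (A t ω) ∂μ) - (∑ t ∈ Finset.Icc 1 T, ℓ t i) ≤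
      3 * √(T * K * Real.log K) + 10 * max (2 * Real.log K) (bestSkip K T d) := by
  have hL : 0 < Real.log K := Real.log_pos (by exact_mod_cast hK)
  have hK0 : 0 < K := by omega
  have hKR : (0 : ℝ) < K := by exact_mod_cast hK0
  have hM : 0 < max (2 * Real.log K) (bestSkip K T d) := lt_max_of_lt_left (by positivity)
  rcases Nat.eq_zero_or_pos T with rfl | hT
  · simp only [zero_lt_one, Icc_eq_empty_of_lt, sum_empty, sub_zero]
    positivity
  have hTR : (1 : ℝ) ≤ T := by exact_mod_cast hT
  have hX : 0 < T * K + (cumCountedMissing K d T : ℝ) := by positivity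
  have hint : ∑ t ∈ Finset.Icc 1 T, ∫ ω, ℓ t (A t ω) ∂μ = ∑ t ∈ Icc 1 T,
      pathExp i (fun t a => distr ℓ d (stepSize K d) (fun _ => 0) a t) (Icc 1 T)
        (fun a => ℓ t (a t)) := by
    refine Finset.sum_congr rfl fun t ht => ?_
    rw [← h.integral_eq i]
    simp only [restrictPath_of_mem ht]
  rw [hint]
  have h1 := sum_pathExp_sub_le (i₀ := i) (d := d) (η := stepSize K d) (γ := fun _ => 0) hK0 hℓ
    (fun _ => le_rfl) (fun t => Real.sqrt_nonneg _)
    (fun t ht => Real.sqrt_pos.2 (by positivity))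
    (fun t ht => sqrt_div_cum_antitone K d hL.le hKR ht (Nat.le_succ t)) hT i
  have h2 := sum_sqrt_mul_le K d hL.le hKR T
  have h3 : ∑ t ∈ Icc 1 T, ((0 + stepSize K d t) * K + stepSize K d t * countedMissing K d t) =
      ∑ t ∈ Icc 1 T, √(Real.log K / (t * K + cumCountedMissing K d t)) *
        (K + countedMissing K d t) := by
    refine Finset.sum_congr rfl fun t _ => ?_
    rw [stepSize]
    ring
  have h4 : Real.log K / stepSize K d T = √(Real.log K * (T * K + cumCountedMissing K d T)) :=
    div_sqrt_div hL hX
  rw [h3, h4] at h1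
  have h5 : √(Real.log K * (T * K + cumCountedMissing K d T)) ≤
      √(T * K * Real.log K) + √(cumCountedMissing K d T * Real.log K) := by
    rw [mul_comm, add_mul]
    exact sqrt_add_le_sqrt_add_sqrt (by positivity) (by positivity)
  -- The delay terms add up to `3 Y + 2 Y = 5 Y ≤ 7 M`.
  have h6 := card_skipped_le (d := d) hK T
  have h7 := sqrt_cumCountedMissing_mul_le (d := d) hK T
  linarith

end ExpectedRegret

/-! ### Deviation events and the pathwise bound outside them. -/

section HighProbability

variable {K : ℕ} {ℓ : ℕ → Fin K → ℝ} {d : ℕ → ℕ} {η γ : ℕ → ℝ} {T : ℕ}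

open MeasureTheory in
theorem IsRun.measureReal_lt_le {Ω : Type*} [MeasurableSpace Ω] {μ : Measure Ω}
    [IsProbabilityMeasure μ] {A : ℕ → Ω → Fin K} (h : IsRun μ T ℓ d η γ A) (hK : 0 < K)
    (i₀ : Fin K) (F : (ℕ → Fin K) → ℝ)
    (hF : pathExp i₀ (fun t a => distr ℓ d η γ a t) (Icc 1 T) (fun a => Real.exp (F a)) ≤ 1)
    (c : ℝ) :
    μ.real {ω | c < F (restrictPath i₀ (Icc 1 T) fun t => A t ω)} ≤ Real.exp (-c) := by
  refine (h.measureReal_le i₀ (fun q a i => (distr_pos hK a q i).le) (fun a => c < F a)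
    (fun a => Real.exp (-c) * Real.exp (F a)) (fun a => by positivity) fun a ha => ?_).trans ?_
  · rw [← Real.exp_add]
    exact Real.one_le_exp (by linarith)
  · rw [pathExp_const_mul]
    exact mul_le_of_le_one_right (Real.exp_pos _).le hF

variable (ℓ d η γ) in
/-- The total weight `∑ η_t p_{t,j}` over the rounds `t` at which round `s` is missing. -/
noncomputable def missingWeight (T : ℕ) (a : ℕ → Fin K) (s : ℕ) (j : Fin K) : ℝ :=
  if s ∈ kept K d T then
    ∑ t ∈ (Icc 1 T).filter (fun t => s ∈ missing d t), η t * distr ℓ d η γ a t j else 0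

theorem missingWeight_nonneg (hK : 0 < K) (hη : ∀ t, 0 ≤ η t) (a : ℕ → Fin K) (s : ℕ)
    (j : Fin K) : 0 ≤ missingWeight ℓ d η γ T a s j := by
  rw [missingWeight]
  split_ifs
  · exact Finset.sum_nonneg fun t _ => mul_nonneg (hη t) (distr_pos hK a t j).le
  · exact le_rfl

/-- The weights involve only `p_t` with `t ≤ s + d_s`, hence are predictable in arrival order. -/
theorem missingWeight_update {s r : ℕ} (h : s + d s ≤ r + d r) (a : ℕ → Fin K) (i : Fin K) :
    missingWeight ℓ d η γ T (update a r i) s = missingWeight ℓ d η γ T a s := by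
  funext j
  rw [missingWeight, missingWeight]
  congr 1
  refine Finset.sum_congr rfl fun t ht => ?_
  have := mem_missing.1 (Finset.mem_filter.1 ht).2
  rw [distr_update (by omega)]

theorem missingWeight_le (hK : 2 ≤ K) (hη : ∀ t, 0 ≤ η t)
    (hanti : ∀ s t, 1 ≤ s → s ≤ t → η t ≤ η s) (a : ℕ → Fin K) (s : ℕ) (j : Fin K) :
    missingWeight ℓ d η γ T a s j ≤ √(cumCountedMissing K d T / Real.log K) * η s := by
  rw [missingWeight]
  split_ifs with hs
  · refine le_trans ?_ (mul_le_mul_of_nonneg_right (card_missing_le hK hs) (hη s))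
    rw [← nsmul_eq_mul]
    refine Finset.sum_le_card_nsmul _ _ _ fun t ht => ?_
    have h1 := mem_missing.1 (Finset.mem_filter.1 ht).2
    exact (mul_le_of_le_one_right (hη t) (distr_le_one (by omega) a t j)).trans
      (hanti s t h1.1 h1.2.1.le)
  · have := hη s
    positivity

/-- Grouping by the missing round instead of the time of decision produces the form to which the
arrival-order moment bound applies. -/
theorem sum_missing_eq (a : ℕ → Fin K) (f : ℕ → Fin K → ℝ) :
    ∑ t ∈ Icc 1 T, η t * ∑ j, distr ℓ d η γ a t j * ∑ s ∈ missing d t ∩ kept K d T, f s j =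
      ∑ s ∈ Icc 1 T, ∑ j, missingWeight ℓ d η γ T a s j * f s j := by
  have e : ∀ t j, ∑ s ∈ missing d t ∩ kept K d T, f s j =
      ∑ s ∈ Icc 1 T, if s ∈ kept K d T then (if s ∈ missing d t then f s j else 0) else 0 := by
    intro t j
    rw [← Finset.sum_filter, ← Finset.sum_filter]
    congr 1
    ext s
    simp only [Finset.mem_inter, Finset.mem_filter, mem_kept, mem_Icc]
    tauto
  simp only [e, Finset.mul_sum]
  rw [Finset.sum_congr rfl fun t _ => Finset.sum_comm, Finset.sum_comm]
  refine Finset.sum_congr rfl fun s _ => ?_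
  rw [Finset.sum_comm]
  refine Finset.sum_congr rfl fun j _ => ?_
  rw [missingWeight]
  by_cases hs : s ∈ kept K d T
  · simp only [hs, if_true]
    rw [Finset.sum_filter, Finset.sum_mul]
    refine Finset.sum_congr rfl fun t _ => ?_
    split_ifs <;> ring
  · simp [hs]

theorem sum_missingWeight_mul_le (hK : 0 < K) (hη : ∀ t, 0 ≤ η t) (a : ℕ → Fin K)
    (hℓ : ∀ t ∈ Finset.Icc 1 T, ∀ i, ℓ t i ∈ Set.Icc (0 : ℝ) 1) :
    ∑ s ∈ Icc 1 T, ∑ j, missingWeight ℓ d η γ T a s j * ℓ s j ≤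
      ∑ t ∈ Icc 1 T, η t * countedMissing K d t := by
  calc _ ≤ ∑ s ∈ Icc 1 T, ∑ j, missingWeight ℓ d η γ T a s j * 1 :=
        Finset.sum_le_sum fun s hs => Finset.sum_le_sum fun j _ =>
          mul_le_mul_of_nonneg_left (hℓ s hs j).2 (missingWeight_nonneg hK hη a s j)
    _ = ∑ t ∈ Icc 1 T, η t * ((missing d t ∩ kept K d T).card : ℝ) := by
        rw [← sum_missing_eq a fun _ _ => 1]
        refine Finset.sum_congr rfl fun t _ => ?_
        rw [← Finset.sum_mul, sum_distr hK]
        simp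
    _ ≤ _ := Finset.sum_le_sum fun t ht => mul_le_mul_of_nonneg_left
        (by exact_mod_cast card_missing_inter_kept_le (mem_Icc.1 ht).2) (hη t)

/-- The deviation of the weighted missing estimates. -/
theorem sum_missing_le (hK : 2 ≤ K) (hη : ∀ t, 0 ≤ η t)
    (hanti : ∀ s t, 1 ≤ s → s ≤ t → η t ≤ η s)
    (hℓ : ∀ t ∈ Finset.Icc 1 T, ∀ i, ℓ t i ∈ Set.Icc (0 : ℝ) 1) (a : ℕ → Fin K) {b c : ℝ}
    (hb : b = √(cumCountedMissing K d T / Real.log K))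
    (h : ∑ s ∈ Icc 1 T, ∑ j, 2 / b * missingWeight ℓ d η γ T a s j *
      (pathEstimate ℓ d η γ a s j - ℓ s j) ≤ c) :
    ∑ t ∈ Icc 1 T, η t * ∑ j, distr ℓ d η γ a t j * missingEstimate ℓ d η γ T a t j ≤
      ∑ t ∈ Icc 1 T, η t * countedMissing K d t + b / 2 * c := by
  have hK0 : 0 < K := by omega
  simp only [missingEstimate]
  rw [sum_missing_eq]
  have hb0 : 0 ≤ b := hb ▸ Real.sqrt_nonneg _
  -- If `b = 0`, then `2 / b = 0` and `h` is empty, but all weights vanish.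
  rcases hb0.eq_or_lt with h0 | hpos
  · have hw : ∀ s j, missingWeight ℓ d η γ T a s j = 0 := by
      intro s j
      have h1 := missingWeight_le (ℓ := ℓ) (d := d) (γ := γ) (T := T) hK hη hanti a s j
      rw [← hb, ← h0, zero_mul] at h1
      exact le_antisymm h1 (missingWeight_nonneg hK0 hη a s j)
    simp only [hw, zero_mul, sum_const_zero, ← h0, zero_div, add_zero]
    exact Finset.sum_nonneg fun t _ => mul_nonneg (hη t) (Nat.cast_nonneg _)
  · have h1 := sum_missingWeight_mul_le (d := d) (γ := γ) hK0 hη a hℓ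
    have h2 : ∑ s ∈ Icc 1 T, ∑ j, 2 / b * missingWeight ℓ d η γ T a s j *
        (pathEstimate ℓ d η γ a s j - ℓ s j) =
        2 / b * (∑ s ∈ Icc 1 T, ∑ j, missingWeight ℓ d η γ T a s j * pathEstimate ℓ d η γ a s j -
          ∑ s ∈ Icc 1 T, ∑ j, missingWeight ℓ d η γ T a s j * ℓ s j) := by
      rw [← Finset.sum_sub_distrib, Finset.mul_sum]
      refine Finset.sum_congr rfl fun s _ => ?_
      rw [← Finset.sum_sub_distrib, Finset.mul_sum]
      exact Finset.sum_congr rfl fun j _ => by ring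
    rw [h2] at h
    have h3 := mul_le_mul_of_nonneg_left h (show 0 ≤ b / 2 by positivity)
    rw [← mul_assoc, div_mul_div_cancel₀ (by norm_num), div_self hpos.ne', one_mul] at h3
    linarith

/-- The pathwise regret bound in the absence of large deviations. -/
theorem regret_le_of_deviations (hK : 2 ≤ K)
    (hℓ : ∀ t ∈ Finset.Icc 1 T, ∀ i, ℓ t i ∈ Set.Icc (0 : ℝ) 1)
    (hη0 : ∀ t, 0 ≤ η t) (hη : ∀ t, 1 ≤ t → 0 < η t)
    (hanti : ∀ s t, 1 ≤ s → s ≤ t → η t ≤ η s) (hT : 1 ≤ T) (a : ℕ → Fin K) {b c₁ c₂ : ℝ}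
    (hb : b = √(cumCountedMissing K d T / Real.log K)) {j : Fin K}
    (hj : ∀ i, ∑ t ∈ kept K d T, ℓ t j ≤ ∑ t ∈ kept K d T, ℓ t i)
    (h₁ : ∑ t ∈ kept K d T, 2 * η T * (pathEstimate ℓ d η η a t j - ℓ t j) ≤ c₁)
    (h₂ : ∑ t ∈ Icc 1 T, (min 1 (drift ℓ d η η T a t) / 2 - 2 / 3 * meanDrift ℓ d η η T a t) ≤ c₂)
    (h₃ : ∑ s ∈ Icc 1 T, ∑ j, 2 / b * missingWeight ℓ d η η T a s j *
      (pathEstimate ℓ d η η a s j - ℓ s j) ≤ c₂) (i : Fin K) :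
    ∑ t ∈ Icc 1 T, (ℓ t (a t) - ℓ t i) ≤
      (skipped K d T).card + Real.log K / η T + c₁ / (2 * η T) + 2 * c₂ +
        4 / 3 * (∑ t ∈ Icc 1 T, η t * (2 * K + countedMissing K d t) + b / 2 * c₂) := by
  have hK0 : 0 < K := by omega
  have hkT : kept K d T ⊆ Icc 1 T := Finset.filter_subset _ _
  have hmean : ∑ t ∈ Icc 1 T, meanDrift ℓ d η η T a t ≤
      ∑ t ∈ Icc 1 T, η t * (2 * K + countedMissing K d t) + b / 2 * c₂ := by
    have h4 := sum_missing_le hK hη0 hanti hℓ a hb h₃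
    simp only [meanDrift, mul_add, Finset.sum_add_distrib] at h4 ⊢
    have : ∑ t ∈ Icc 1 T, (η t + η t) * (K : ℝ) = ∑ t ∈ Icc 1 T, η t * (2 * K) :=
      Finset.sum_congr rfl fun t _ => by ring
    linarith
  have hdrift : ∑ t ∈ kept K d T, min 1 (drift ℓ d η η T a t) ≤
      2 * c₂ + 4 / 3 * ∑ t ∈ Icc 1 T, meanDrift ℓ d η η T a t := by
    refine (Finset.sum_le_sum_of_subset_of_nonneg hkT fun t ht _ =>
      le_min zero_le_one (drift_nonneg hK0 hℓ hη0 hη0 a ht)).trans ?_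
    rw [Finset.sum_sub_distrib, ← Finset.sum_div, ← Finset.mul_sum] at h₂
    linarith
  have hest : ∑ t ∈ kept K d T, pathEstimate ℓ d η η a t j ≤
      ∑ t ∈ kept K d T, ℓ t j + c₁ / (2 * η T) := by
    have h4 := hη T hT
    rw [← Finset.mul_sum, Finset.sum_sub_distrib] at h₁
    have h5 := (le_div_iff₀' (by positivity : 0 < 2 * η T)).2 h₁
    linarith
  have hkept := sum_kept_le (d := d) hK0 hℓ hη0 hη0 hη (fun t ht => hanti t (t + 1) ht (by omega))
    hT a j
  have hskip : ∑ t ∈ skipped K d T, (ℓ t (a t) - ℓ t i) ≤ (skipped K d T).card := by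
    rw [Finset.card_eq_sum_ones, Nat.cast_sum]
    refine Finset.sum_le_sum fun t ht => ?_
    have htT : t ∈ Icc 1 T := (Finset.mem_filter.1 ht).1
    have h4 := (hℓ t htT i).1
    have h5 := (hℓ t htT (a t)).2
    push_cast
    linarith
  rw [sum_eq_sum_kept_add (K := K) (d := d), Finset.sum_sub_distrib]
  have := hj i
  linarith

/-- The comparison of the deviation bound with the claimed one. -/
theorem deviation_bound_le {Y H L M x : ℝ} (hY0 : 0 ≤ Y) (hH : 0 ≤ H) (hL : 0 < L)
    (hYM : Y ≤ 7 / 5 * M) (hLM : 2 * L ≤ M) (hHLM : 20 * (L * M) ≤ H ^ 2) (hx : 0 ≤ x) :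
    2 * Y + 2 * √3 * √(2 * H ^ 2 + Y ^ 2) + x * √(2 * H ^ 2 + Y ^ 2) / √3 +
        (1 + x) * (2 * L + 2 / 3 * Y) ≤
      (2 * √6 + √(2 / 3) * x) * H + (4 * (√3 + 1) + (1 + 2 / √3) * x) * M := by
  have hM : 0 < M := by linarith
  set h := √2 * H with hh
  set q := √3 with hq
  have hq3 : q ^ 2 = 3 := Real.sq_sqrt (by norm_num)
  have hq0 : 0 < q := Real.sqrt_pos.2 (by norm_num)
  have hq1 : 1.73 < q := by
    rw [hq, Real.lt_sqrt (by norm_num)]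
    norm_num
  have hq2 : q < 1.7321 := by
    rw [hq, Real.sqrt_lt' (by norm_num)]
    norm_num
  have hh2 : h ^ 2 = 2 * H ^ 2 := by rw [hh, mul_pow, Real.sq_sqrt (by norm_num)]
  have hh0 : 0 ≤ h := by positivity
  have hinv : 1 / q = q / 3 := by
    field_simp
    linarith
  have e6 : √6 * H = q * h := by
    rw [hh, hq, ← mul_assoc, ← Real.sqrt_mul (by norm_num)]
    norm_num
  have e23 : √(2 / 3) * H = q / 3 * h := by
    rw [Real.sqrt_div (by norm_num), div_mul_eq_mul_div, ← hh, ← hinv]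
    ring
  set Z := √(2 * H ^ 2 + Y ^ 2) with hZ
  have hZ0 : 0 ≤ Z := Real.sqrt_nonneg _
  have hZ1 : Z ≤ h + Y := by
    rw [hZ, Real.sqrt_le_iff]
    refine ⟨by positivity, ?_⟩
    nlinarith [mul_nonneg hh0 hY0]
  -- The coefficient of `x`. If `5 L ≤ M`, the estimate `Z ≤ h + Y` suffices. Otherwise `hHLM` gives
  -- `h ≥ 2.8 M ≥ 2 Y`, which sharpens it to `Z ≤ h + Y / 4`.
  have main : q / 3 * Z + (2 * L + 2 / 3 * Y) ≤ q / 3 * h + (1 + 2 * (q / 3)) * M := by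
    rcases le_total (5 * L) M with h5 | h5
    · have h6 : q / 3 * Z ≤ q / 3 * (h + Y) := mul_le_mul_of_nonneg_left hZ1 (by positivity)
      have h7 : q / 3 * Y ≤ q / 3 * (7 / 5 * M) := mul_le_mul_of_nonneg_left hYM (by positivity)
      have h8 : 1.73 * M ≤ q * M := mul_le_mul_of_nonneg_right hq1.le hM.le
      nlinarith
    · have h6 : 8 * M ^ 2 ≤ h ^ 2 := by
        rw [hh2]
        nlinarith
      have h7 : 2.8 * M ≤ h := by
        exact (pow_le_pow_iff_left₀ (by positivity) hh0 two_ne_zero).1 (by nlinarith)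
      have h8 : Z ≤ h + 1 / 4 * Y := by
        rw [hZ, Real.sqrt_le_iff]
        refine ⟨by positivity, ?_⟩
        have h9 := mul_le_mul_of_nonneg_right h7 hY0
        have h10 := mul_le_mul_of_nonneg_right hYM hY0
        nlinarith [sq_nonneg Y]
      have h9 : q / 3 * Z ≤ q / 3 * (h + 1 / 4 * Y) :=
        mul_le_mul_of_nonneg_left h8 (by positivity)
      have h10 : q / 3 * Y ≤ q / 3 * (7 / 5 * M) := mul_le_mul_of_nonneg_left hYM (by positivity)
      have h11 : 1.73 * M ≤ q * M := mul_le_mul_of_nonneg_right hq1.le hM.le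
      nlinarith
  have main0 : 2 * Y + 2 * q * Z + (2 * L + 2 / 3 * Y) ≤ 2 * (q * h) + 4 * (q + 1) * M := by
    have h6 : q * Z ≤ q * (h + Y) := mul_le_mul_of_nonneg_left hZ1 hq0.le
    have h7 : q * Y ≤ q * (7 / 5 * M) := mul_le_mul_of_nonneg_left hYM hq0.le
    have h8 : 1.73 * M ≤ q * M := mul_le_mul_of_nonneg_right hq1.le hM.le
    nlinarith
  have hmain := mul_le_mul_of_nonneg_left main hx
  have e1 : x * Z / q = x * (q / 3 * Z) := by rw [← hinv]; ring
  have e2 : (2 : ℝ) / q = 2 * (q / 3) := by rw [← hinv]; ring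
  rw [e1, e2]
  calc _ = 2 * Y + 2 * q * Z + (2 * L + 2 / 3 * Y) + x * (q / 3 * Z + (2 * L + 2 / 3 * Y)) := by
        ring
    _ ≤ 2 * (q * h) + 4 * (q + 1) * M + x * (q / 3 * h + (1 + 2 * (q / 3)) * M) := by linarith
    _ = _ := by
        rw [← e6, ← e23]
        ring

end HighProbability

/-! ### The high-probability bound. -/

section HighProbabilityRegret

variable {K : ℕ} {ℓ : ℕ → Fin K → ℝ} {d : ℕ → ℕ} {T : ℕ}

theorem stepSizeIX_eq (K : ℕ) (d : ℕ → ℕ) (t : ℕ) : stepSizeIX K d t =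
    √3 / 2 * √(Real.log K / (t * (2 * K) + cumCountedMissing K d t)) := by
  rw [stepSizeIX, mul_div_assoc, Real.sqrt_mul (by norm_num)]
  have : 2 * (t : ℝ) * K = t * (2 * K) := by ring
  rw [this]
  ring

theorem stepSizeIX_nonneg (K : ℕ) (d : ℕ → ℕ) (t : ℕ) : 0 ≤ stepSizeIX K d t := by
  rw [stepSizeIX]
  positivity

theorem stepSizeIX_pos (hK : 2 ≤ K) (d : ℕ → ℕ) {t : ℕ} (ht : 1 ≤ t) : 0 < stepSizeIX K d t := by
  have hL : 0 < Real.log K := Real.log_pos (by exact_mod_cast hK)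
  have : 0 < K := by omega
  rw [stepSizeIX]
  positivity

theorem stepSizeIX_antitone (hK : 2 ≤ K) (d : ℕ → ℕ) (s t : ℕ) (hs : 1 ≤ s) (hst : s ≤ t) :
    stepSizeIX K d t ≤ stepSizeIX K d s := by
  have hL : 0 < Real.log K := Real.log_pos (by exact_mod_cast hK)
  have : 0 < K := by omega
  rw [stepSizeIX_eq, stepSizeIX_eq]
  exact mul_le_mul_of_nonneg_left (sqrt_div_cum_antitone K d hL.le (by positivity) hs hst)
    (by positivity)

/-- The step sizes for implicit exploration turn the deviation bound into an explicit one. -/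
theorem stepSizeIX_bound_le (hK : 2 ≤ K) (hT : 1 ≤ T) {c₁ c₂ : ℝ} (hc₁ : 0 ≤ c₁)
    (hc₂ : c₂ ≤ Real.log K + c₁)
    (hTM : 10 * max (2 * Real.log K) (bestSkip K T d) ≤ T) :
    (skipped K d T).card + Real.log K / stepSizeIX K d T + c₁ / (2 * stepSizeIX K d T) + 2 * c₂ +
        4 / 3 * (∑ t ∈ Icc 1 T, stepSizeIX K d t * (2 * K + countedMissing K d t) +
          √(cumCountedMissing K d T / Real.log K) / 2 * c₂) ≤
      (2 * √6 + √(2 / 3) * (c₁ / Real.log K)) * √(K * T * Real.log K) +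
        (4 * (√3 + 1) + (1 + 2 / √3) * (c₁ / Real.log K)) *
          max (2 * Real.log K) (bestSkip K T d) := by
  have hL : 0 < Real.log K := Real.log_pos (by exact_mod_cast hK)
  have hK2 : (2 : ℝ) ≤ K := by exact_mod_cast hK
  have hTR : (1 : ℝ) ≤ T := by exact_mod_cast hT
  have hYM := sqrt_cumCountedMissing_mul_le (d := d) hK T
  have hN := card_skipped_le (d := d) hK T
  set M := max (2 * Real.log K) (bestSkip K T d)
  have hLM : 2 * Real.log K ≤ M := le_max_left _ _
  set L := Real.log K
  set D : ℝ := ((cumCountedMissing K d T : ℕ) : ℝ) with hD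
  have hD0 : 0 ≤ D := Nat.cast_nonneg _
  set Y := √(D * L)
  have hX : 0 < T * (2 * (K : ℝ)) + D := by positivity
  set H := √(K * T * L) with hH
  have hH2 : H ^ 2 = K * T * L := Real.sq_sqrt (by positivity)
  set Z := √(2 * H ^ 2 + Y ^ 2) with hZ
  have hZ' : √(L * (T * (2 * K) + D)) = Z := by
    rw [hZ, hH2, Real.sq_sqrt (by positivity)]
    congr 1
    ring
  have hHLM : 20 * (L * M) ≤ H ^ 2 := by
    rw [hH2]
    have h1 : 2 * (10 * M) ≤ K * T := mul_le_mul hK2 hTM (by linarith) (by linarith)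
    nlinarith
  have hq3 : √3 ^ 2 = 3 := Real.sq_sqrt (by norm_num)
  have hq0 : 0 < √3 := Real.sqrt_pos.2 (by norm_num)
  have hb : √(D / L) * L = Y := by
    rw [Real.sqrt_div hD0, div_mul_eq_mul_div, mul_div_assoc, Real.div_sqrt,
      ← Real.sqrt_mul hD0]
  have hη : stepSizeIX K d T = √3 / 2 * √(L / (T * (2 * K) + D)) := stepSizeIX_eq K d T
  have hpos : 0 < √(L / (T * (2 * K) + D)) := Real.sqrt_pos.2 (by positivity)
  have h1 : L / stepSizeIX K d T = 2 / √3 * Z := by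
    rw [hη, ← hZ', ← div_sqrt_div hL hX]
    field_simp
  have h2 : c₁ / (2 * stepSizeIX K d T) = c₁ / L * Z / √3 := by
    have : c₁ / (2 * stepSizeIX K d T) = c₁ / L * (L / stepSizeIX K d T) / 2 := by
      field_simp
    rw [this, h1]
    ring
  have h3 : ∑ t ∈ Icc 1 T, stepSizeIX K d t * (2 * K + countedMissing K d t) ≤ √3 * Z := by
    have h4 := sum_sqrt_mul_le K d hL.le (show (0 : ℝ) < 2 * K by positivity) T
    rw [← hD, hZ'] at h4
    simp only [stepSizeIX_eq, mul_assoc (√3 / 2)]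
    rw [← Finset.mul_sum]
    have h5 := mul_le_mul_of_nonneg_left h4 (show 0 ≤ √3 / 2 by positivity)
    linarith
  have h4 : √(D / L) / 2 * c₂ ≤ Y / 2 * (1 + c₁ / L) := by
    have h5 := mul_le_mul_of_nonneg_left hc₂ (show 0 ≤ √(D / L) / 2 by positivity)
    refine h5.trans_eq ?_
    rw [← hb]
    field_simp
  have h5 : c₂ ≤ (1 + c₁ / L) * L := by
    refine hc₂.trans_eq ?_
    field_simp
  have h6 := deviation_bound_le (Real.sqrt_nonneg (D * L)) (Real.sqrt_nonneg (K * T * L)) hL hYM hLM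
    hHLM (show 0 ≤ c₁ / L by positivity)
  have h7 : 2 / √3 * Z + 4 / 3 * (√3 * Z) = 2 * √3 * Z := by
    field_simp
    rw [hq3]
    ring
  rw [h1, h2]
  refine le_trans ?_ h6
  linarith

open MeasureTheory in
theorem high_probability_regret_le (hK : 2 ≤ K) {Ω : Type*} [MeasurableSpace Ω] {μ : Measure Ω}
    [IsProbabilityMeasure μ] {A : ℕ → Ω → Fin K}
    (hℓ : ∀ t ∈ Finset.Icc 1 T, ∀ i, ℓ t i ∈ Set.Icc (0 : ℝ) 1)
    (h : IsRun μ T ℓ d (stepSizeIX K d) (stepSizeIX K d) A) {δ : ℝ}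
    (hδ : δ ∈ Set.Ioo (0 : ℝ) 1) :
    1 - δ ≤ μ.real {ω | ∀ i : Fin K,
      ∑ t ∈ Finset.Icc 1 T, (ℓ t (A t ω) - ℓ t i) ≤
        (2 * √6 + √(2 / 3) * (Real.log (2 / δ) / Real.log K)) * √(K * T * Real.log K) +
        (4 * (√3 + 1) + (1 + 2 / √3) * (Real.log (2 / δ) / Real.log K)) *
          max (2 * Real.log K) (bestSkip K T d)} := by
  obtain ⟨hδ0, hδ1⟩ := hδ
  have hK0 : 0 < K := by omega
  have hL : 0 < Real.log K := Real.log_pos (by exact_mod_cast hK)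
  have hc₁ : 0 ≤ Real.log (2 / δ) := Real.log_nonneg (by rw [le_div_iff₀ hδ0]; linarith)
  set c₁ := Real.log (2 / δ) with hc₁_def
  set M := max (2 * Real.log K) (bestSkip K T d)
  have hM : 0 < M := lt_max_of_lt_left (by positivity)
  set B := (2 * √6 + √(2 / 3) * (c₁ / Real.log K)) * √(K * T * Real.log K) +
    (4 * (√3 + 1) + (1 + 2 / √3) * (c₁ / Real.log K)) * M with hB
  have hBM : 10 * M ≤ B := by
    have h1 : 1.7 < √3 := by
      rw [Real.lt_sqrt (by norm_num)]
      norm_num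
    have h2 : 0 ≤ (2 * √6 + √(2 / 3) * (c₁ / Real.log K)) * √(K * T * Real.log K) := by positivity
    have h3 : 0 ≤ (1 + 2 / √3) * (c₁ / Real.log K) * M := by positivity
    have h4 := mul_lt_mul_of_pos_right h1 hM
    rw [hB]
    linarith
  -- The regret never exceeds `T`, so one may assume `10 M ≤ B < T`, which the comparison of
  -- constants needs.
  rcases le_or_gt (T : ℝ) B with hTB | hTB
  · have huniv : {ω | ∀ i : Fin K, ∑ t ∈ Icc 1 T, (ℓ t (A t ω) - ℓ t i) ≤ B} = Set.univ := by
      refine Set.eq_univ_of_forall fun ω i => le_trans ?_ hTB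
      have h1 : ∑ t ∈ Icc 1 T, (ℓ t (A t ω) - ℓ t i) ≤ (Icc 1 T).card • (1 : ℝ) :=
        Finset.sum_le_card_nsmul _ _ _ fun t ht => by
          linarith [(hℓ t ht (A t ω)).2, (hℓ t ht i).1]
      simpa using h1
    rw [huniv, probReal_univ]
    linarith
  have hT : 1 ≤ T := by
    rcases Nat.eq_zero_or_pos T with rfl | h0
    · push_cast at hTB
      linarith
    · exact h0
  set η := stepSizeIX K d
  have hη0 : ∀ t, 0 ≤ η t := stepSizeIX_nonneg K d
  have hη : ∀ t, 1 ≤ t → 0 < η t := fun t ht => stepSizeIX_pos hK d ht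
  have hanti : ∀ s t, 1 ≤ s → s ≤ t → η t ≤ η s := stepSizeIX_antitone hK d
  have : Nonempty (Fin K) := ⟨⟨0, hK0⟩⟩
  -- The losses and the kept set are deterministic, so one best action serves as comparator for all,
  -- without a union bound over actions.
  obtain ⟨j, hj⟩ := Finite.exists_min fun i => ∑ t ∈ kept K d T, ℓ t i
  -- The failure probability is split as `δ/2 + δ/4 + δ/4`; since `K ≥ 2`, the smaller shares cost
  -- at most an extra `log K`.
  have hc₂ : Real.log (4 / δ) ≤ Real.log K + c₁ := by
    rw [hc₁_def, ← Real.log_mul (by positivity) (by positivity)]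
    refine Real.log_le_log (by positivity) ?_
    have hK2 : (2 : ℝ) ≤ K := by exact_mod_cast hK
    rw [← mul_div_assoc]
    gcongr
    linarith
  set c₂ := Real.log (4 / δ) with hc₂_def
  set b := √(cumCountedMissing K d T / Real.log K) with hb
  have hb0 : 0 ≤ b := Real.sqrt_nonneg _
  have hkT : kept K d T ⊆ Icc 1 T := Finset.filter_subset _ _
  set F₁ : (ℕ → Fin K) → ℝ := fun a => ∑ s ∈ Icc 1 T, ∑ i,
    (if s ∈ kept K d T ∧ i = j then 2 * η T else 0) * (pathEstimate ℓ d η η a s i - ℓ s i)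
  set F₂ : (ℕ → Fin K) → ℝ := fun a => ∑ t ∈ Icc 1 T,
    (min 1 (drift ℓ d η η T a t) / 2 - 2 / 3 * meanDrift ℓ d η η T a t)
  set F₃ : (ℕ → Fin K) → ℝ := fun a => ∑ s ∈ Icc 1 T, ∑ i,
    2 / b * missingWeight ℓ d η η T a s i * (pathEstimate ℓ d η η a s i - ℓ s i)
  have hF₁ : ∀ a, F₁ a = ∑ t ∈ kept K d T, 2 * η T * (pathEstimate ℓ d η η a t j - ℓ t j) := by
    intro a
    rw [← Finset.inter_eq_right.2 hkT, ← Finset.filter_mem_eq_inter, Finset.sum_filter]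
    refine Finset.sum_congr rfl fun s _ => ?_
    by_cases hs : s ∈ kept K d T <;> simp [hs]
  have P₁ := h.measureReal_lt_le hK0 j F₁ (pathExp_exp_estimate_le hK0 hℓ
    (fun s _ i => if s ∈ kept K d T ∧ i = j then 2 * η T else 0)
    (fun s a i => by
      have := hη0 T
      positivity)
    (fun s a i => by
      have := hη0 s
      split_ifs with hs
      · have := mem_kept.1 hs.1
        linarith [hanti s T this.1.1 this.1.2]
      · positivity)
    (fun _ _ _ _ _ => rfl)) c₁
  have P₂ := h.measureReal_lt_le hK0 j F₂ (pathExp_exp_drift_le hK0 hℓ hη0 hη0) c₂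
  have P₃ := h.measureReal_lt_le hK0 j F₃ (pathExp_exp_estimate_le hK0 hℓ
    (fun s a i => 2 / b * missingWeight ℓ d η η T a s i)
    (fun s a i => mul_nonneg (by positivity) (missingWeight_nonneg hK0 hη0 a s i))
    (fun s a i => by
      -- The factor `2 / b` is the largest the bound `missingWeight ≤ b η_s` allows under the limit
      -- `2 γ_s`; for `b = 0` it is 0 by convention.
      rcases hb0.eq_or_lt with h0 | hpos
      · rw [← h0]
        have := hη0 s
        simpa using this
      · have h1 := missingWeight_le (ℓ := ℓ) (d := d) (γ := η) (T := T) hK hη0 hanti a s i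
        rw [div_mul_eq_mul_div, div_le_iff₀ hpos]
        linarith)
    (fun s r hsr a i => by rw [missingWeight_update hsr])) c₂
  set r : Ω → ℕ → Fin K := fun ω => restrictPath j (Icc 1 T) fun t => A t ω with hr
  have e₁ : Real.exp (-c₁) = δ / 2 := by
    rw [Real.exp_neg, Real.exp_log (by positivity), inv_div]
  have e₂ : Real.exp (-c₂) = δ / 4 := by
    rw [Real.exp_neg, Real.exp_log (by positivity), inv_div]
  rw [e₁] at P₁
  rw [e₂] at P₂ P₃
  set G := {ω | ∀ i : Fin K, ∑ t ∈ Icc 1 T, (ℓ t (A t ω) - ℓ t i) ≤ B}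
  have hcover : (Set.univ : Set Ω) ⊆
      G ∪ ({ω | c₁ < F₁ (r ω)} ∪ ({ω | c₂ < F₂ (r ω)} ∪ {ω | c₂ < F₃ (r ω)})) := by
    intro ω _
    by_contra hω
    simp only [Set.mem_union, Set.mem_ofPred_eq, not_or, not_lt] at hω
    obtain ⟨hG, h₁, h₂, h₃⟩ := hω
    refine hG fun i => ?_
    have hreg := (regret_le_of_deviations hK hℓ hη0 hη hanti hT (r ω) hb hj (hF₁ _ ▸ h₁) h₂ h₃
      i).trans (stepSizeIX_bound_le hK hT hc₁ hc₂ (hBM.trans hTB.le))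
    refine le_trans (le_of_eq ?_) hreg
    refine Finset.sum_congr rfl fun t ht => ?_
    rw [hr]
    simp only [restrictPath_of_mem ht]
  have hle := measureReal_mono (μ := μ) hcover
  rw [probReal_univ] at hle
  have u₁ := measureReal_union_le (μ := μ) G
    ({ω | c₁ < F₁ (r ω)} ∪ ({ω | c₂ < F₂ (r ω)} ∪ {ω | c₂ < F₃ (r ω)}))
  have u₂ := measureReal_union_le (μ := μ) {ω | c₁ < F₁ (r ω)}
    ({ω | c₂ < F₂ (r ω)} ∪ {ω | c₂ < F₃ (r ω)})
  have u₃ := measureReal_union_le (μ := μ) {ω | c₂ < F₂ (r ω)} {ω | c₂ < F₃ (r ω)}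
  linarith

end HighProbabilityRegret

end DelayedBandit

theorem mainTheorem5 {K : ℕ} (hK : 2 ≤ K) (T : ℕ)
    (ℓ : ℕ → Fin K → ℝ) (hℓ : ∀ t ∈ Finset.Icc 1 T, ∀ i, ℓ t i ∈ Set.Icc (0 : ℝ) 1)
    (d : ℕ → ℕ)
    {Ω : Type*} [MeasurableSpace Ω] (μ : MeasureTheory.Measure Ω)
    [MeasureTheory.IsProbabilityMeasure μ] (A : ℕ → Ω → Fin K) :
    (DelayedBandit.IsRun μ T ℓ d (DelayedBandit.stepSize K d) (fun _ => 0) A →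
      ∀ i : Fin K,
        (∑ t ∈ Finset.Icc 1 T, ∫ ω, ℓ t (A t ω) ∂μ) - (∑ t ∈ Finset.Icc 1 T, ℓ t i) ≤
          3 * √(T * K * Real.log K) +
            10 * max (2 * Real.log K) (DelayedBandit.bestSkip K T d)) ∧
    (DelayedBandit.IsRun μ T ℓ d (DelayedBandit.stepSizeIX K d) (DelayedBandit.stepSizeIX K d) A →
      ∀ δ ∈ Set.Ioo (0 : ℝ) 1,
        1 - δ ≤ μ.real {ω | ∀ i : Fin K,
          ∑ t ∈ Finset.Icc 1 T, (ℓ t (A t ω) - ℓ t i) ≤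
            (2 * √6 + √(2 / 3) * (Real.log (2 / δ) / Real.log K)) * √(K * T * Real.log K) +
            (4 * (√3 + 1) + (1 + 2 / √3) * (Real.log (2 / δ) / Real.log K)) *
              max (2 * Real.log K) (DelayedBandit.bestSkip K T d)}) := by
  exact ⟨fun h i => DelayedBandit.expected_regret_le hK hℓ h i,
    fun h δ hδ => DelayedBandit.high_probability_regret_le hK hℓ h hδ⟩
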